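/- **Theorem (Burn identity).** *Setting.* An anonymous block-building process maps a miner advice $a$ and a finite list of bids $b_1,\dots,b_m$ to an allocation probability in $[0,1]$ and a payment for every bid, and to a burn; relabelling the bids relabels the outcome. The $n$ users have values $v_1,\dots,v_n$ drawn independently from $\mathcal D$. An off-chain mechanism collects one message from every user and, depending on all messages, chooses the advice, the bid submitted by each user or its censoring (a censored user is not allocated and pays nothing on-chain), the bids fabricated by the miner, and off-chain transfers between the users and the miner. A profile of user strategies (maps from values to messages), with well-defined expected payoffs, is a Bayes–Nash equilibrium if no user, whatever his value in $\operatorname{supp}\mathcal D$, gains in expected utility (value times allocation minus total payment) by sending another message or by not participating, which gives utility $0$. The miner's expected net revenue is the expected sum of all users' payments (on-chain and off-chain) minus the expected burn. The pair $(\bar X,\bar B)$ is the value allocation and burn rule of a *Myerson-in-Range* mechanism for $\mathcal D$ if, for every $n\ge 0$, there are an off-chain mechanism for $n$ users and an equilibrium of it that maximize the expected net revenue over all off-chain mechanisms and all their equilibria, such that $\bar X(\vec v)\in[0,1]^n$ and $\bar B(\vec v)\in\mathbb R$ are the resulting users' allocation and burn at every value profile $\vec v$. The distribution $\mathcal D$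 on $\mathbb R$ has cdf $F$ and, except for a possible atom at the supremum of its support, a density $f$; its virtual value is $\varphi(v)=v-\frac{1-F(v)}{f(v)}$ (so $\varphi(v)=v$ where $F(v)=1$, and $\varphi(v)=-\infty$ where $f(v)=0$, $F(v)<1$). It is *regular* if $\varphi$ is non-decreasing (in particular $f>0$ where $0<F<1$), and *smooth* if $\varphi$ is continuous and $\Pr_{v\sim\mathcal D}[\varphi(v)\le 0]>0$. Monotonicity and continuity are required on the points of the support at which $\varphi$ is finite. Write $\varphi(\vec v)=(\varphi(v_1),\dots,\varphi(v_n))$. *Statement.* Let $(\bar X,\bar B)$ be the value allocation and burn rule of a Myerson-in-Range mechanism for a smooth regular distribution $\mathcal D$. Then there is a family of functions $U^n:\mathbb R^n\to\mathbb R$, $n\ge 0$, such that for all $n$: 1. $U^n$ is convex and non-decreasing in every coordinate. 2. For every profile $\vec v$ of values in $\operatorname{supp}\mathcal D$ with finite virtual values and every $i$ with $\varphi(v_i)<0$, the partial derivative $\nabla_i U^n(\varphi(\vec v))$ exists and equals $0$. 3. For every $t\ge 0$ and all $v_1,\dots,v_{n+t}\in\operatorname{supp}\mathcal D$ with finite virtual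 values such that $\varphi(v_{n+k})\le 0$ for $1\le k\le t$, $$U^{n+t}(\varphi(v_1),\dots,\varphi(v_{n+t}))=U^n(\varphi(v_1),\dots,\varphi(v_n)).$$ 4. With probability $1$ for $\vec v\sim\mathcal D^n$, the vector $\bar X(\vec v)$ is a subgradient of $U^n$ at $\varphi(\vec v)$, so that $\bar X(\vec v)=\nabla U^n(\varphi(\vec v))$ whenever this gradient exists, and $$\bar B(\vec v)=\sum_{i=1}^n\varphi(v_i)\,\bar X_i(\vec v)-U^n(\varphi(\vec v)).$$ If moreover $\Pr_{v\sim\mathcal D}[\varphi(v)=c]=0$ for every $c\in\mathbb R$, then with probability $1$ the gradient exists, so that $$\bar X(\vec v)=\nabla U^n(\varphi(\vec v)),\qquad \bar B(\vec v)=\sum_{i=1}^n\varphi(v_i)\,\nabla_iU^n(\varphi(\vec v))-U^n(\varphi(\vec v)).$$ -/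

import Mathlib

open MeasureTheory ProbabilityTheory

noncomputable section

namespace TFM

/-! ### Value distributions -/

/-- The virtual value `φ(v) = v - (1 - F(v)) / f(v)`, where `F` is the cdf of `D` and `f` a density.
At a finite top of the support one has `F(v) = 1`, so `φ(v) = v` there. -/
def virtualValue (D : Measure ℝ) (f : ℝ → ℝ) (v : ℝ) : ℝ :=
  v - (1 - cdf D v) / f v

/-- The values at which the virtual value is a real number: the points of the support at which the
density is positive or the cdf equals one.  (At a point with `f(v) = 0` and `F(v) < 1` the virtual
value is `-∞`.) -/
def valueDomain (D : Measure ℝ) (f : ℝ → ℝ) : Set ℝ :=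
  {v | v ∈ D.support ∧ (0 < f v ∨ cdf D v = 1)}

/-- `D` is a regular distribution with density `f`: away from a possible atom at the top of the
support `D` has density `f`, and the virtual value is non-decreasing.  The field `density_pos` is part
of monotonicity: a zero of `f` at a point with `0 < F(v) < 1` would give the virtual value `-∞`
above a value with a finite virtual value. -/
structure IsRegular (D : Measure ℝ) (f : ℝ → ℝ) : Prop where
  prob : IsProbabilityMeasure D
  measurable_density : Measurable f
  density_nonneg : ∀ v, 0 ≤ f v
  hasDensity : D.restrict {v | cdf D v < 1} =
    (volume.withDensity fun v => ENNReal.ofReal (f v)).restrict {v | cdf D v < 1}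
  density_pos : ∀ v, 0 < cdf D v → cdf D v < 1 → 0 < f v
  mono : MonotoneOn (virtualValue D f) (valueDomain D f)

/-- A distribution is smooth if its virtual value is continuous and non-positive with positive
probability. -/
structure IsSmooth (D : Measure ℝ) (f : ℝ → ℝ) : Prop where
  cont : ContinuousOn (virtualValue D f) (valueDomain D f)
  nonpos_pos : 0 < D {v | virtualValue D f v ≤ 0}

/-- The distribution `D^n` of the value profile of `n` users. -/
abbrev profileLaw (D : Measure ℝ) (n : ℕ) : Measure (Fin n → ℝ) :=
  Measure.pi fun _ => D

/-! ### Transaction fee mechanisms -/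

/-- An anonymous block-building process with miner advice in `Advice` and bids in `Bid`.
On advice `a` and bids `b 0, …, b (m - 1)` it allocates bid `k` with probability `alloc a b k`,
charges it the (expected) payment `pay a b k` and burns the (expected) amount `burn a b`. -/
structure BlockBuildingProcess (Advice : Type*) (Bid : Type*) where
  alloc : Advice → {m : ℕ} → (Fin m → Bid) → Fin m → ℝ
  pay : Advice → {m : ℕ} → (Fin m → Bid) → Fin m → ℝ
  burn : Advice → {m : ℕ} → (Fin m → Bid) → ℝ
  alloc_mem : ∀ a (m : ℕ) (b : Fin m → Bid) k, alloc a b k ∈ Set.Icc (0 : ℝ) 1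
  alloc_anon : ∀ a (m : ℕ) (b : Fin m → Bid) (π : Equiv.Perm (Fin m)) k,
    alloc a (b ∘ π) k = alloc a b (π k)
  pay_anon : ∀ a (m : ℕ) (b : Fin m → Bid) (π : Equiv.Perm (Fin m)) k,
    pay a (b ∘ π) k = pay a b (π k)
  burn_anon : ∀ a (m : ℕ) (b : Fin m → Bid) (π : Equiv.Perm (Fin m)),
    burn a (b ∘ π) = burn a b

/-- A joint play of the miner and `n` users on-chain: the advice, the list of bids that reaches the
block-building process, and for every user the position of his bid in that list, or `none` if he is
censored.  The positions that belong to no user hold bids fabricated by the miner. -/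
structure OnChainPlay (Advice : Type*) (Bid : Type*) (n : ℕ) where
  advice : Advice
  size : ℕ
  bids : Fin size → Bid
  slot : Fin n → Option (Fin size)
  slot_inj : ∀ i j k, slot i = some k → slot j = some k → i = j

variable {Advice : Type*} {Bid : Type*} {n : ℕ}

namespace OnChainPlay

/-- The allocation of user `i`; a censored user is not allocated. -/
def userAlloc (p : OnChainPlay Advice Bid n) (B : BlockBuildingProcess Advice Bid) (i : Fin n) : ℝ :=
  (p.slot i).elim 0 (B.alloc p.advice p.bids)

/-- The on-chain payment of user `i`; a censored user pays nothing. -/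
def userPay (p : OnChainPlay Advice Bid n) (B : BlockBuildingProcess Advice Bid) (i : Fin n) : ℝ :=
  (p.slot i).elim 0 (B.pay p.advice p.bids)

/-- The amount burnt. -/
def burnt (p : OnChainPlay Advice Bid n) (B : BlockBuildingProcess Advice Bid) : ℝ :=
  B.burn p.advice p.bids

end OnChainPlay

/-- An off-chain mechanism for `n` users: it collects a message from every user, dictates the whole
on-chain play and charges off-chain transfers (of either sign) from the users to the miner. -/
structure OffChainMechanism (Advice : Type*) (Bid : Type*) (n : ℕ) where
  Msg : Fin n → Type
  play : (∀ i, Msg i) → OnChainPlay Advice Bid n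
  transfer : (∀ i, Msg i) → Fin n → ℝ

namespace OffChainMechanism

variable (M : OffChainMechanism Advice Bid n) (B : BlockBuildingProcess Advice Bid)
  (D : Measure ℝ) (s : ∀ i, ℝ → M.Msg i)

/-- The total payment of user `i`, on-chain and off-chain. -/
def totalPay (u : ∀ i, M.Msg i) (i : Fin n) : ℝ :=
  (M.play u).userPay B i + M.transfer u i

/-- The messages that the users send under the strategies `s` at the value profile `v`. -/
def messages (v : Fin n → ℝ) : ∀ i, M.Msg i := fun i => s i (v i)

/-- The same, except that user `i` sends the message `m`. -/
def messagesWith (i : Fin n) (m : M.Msg i) (v : Fin n → ℝ) : ∀ j, M.Msg j :=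
  Function.update (M.messages s v) i m

/-- The expected utility of user `i` with value `x` who sends the message `m` while the other users,
whose values are independent draws from `D`, follow `s`.  (The integrand does not depend on the
coordinate `v i`.) -/
def interimUtility (i : Fin n) (x : ℝ) (m : M.Msg i) : ℝ :=
  ∫ v, (x * (M.play (M.messagesWith s i m v)).userAlloc B i
    - M.totalPay B (M.messagesWith s i m v) i) ∂(profileLaw D n)

/-- `s` is a Bayes-Nash equilibrium of the off-chain game with off-chain mechanism `M`.  The first
five fields say that all expected payoffs exist.  No message is a profitable deviation for a user
with any value in the support, and neither is staying away, which gives utility zero. -/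
structure IsBNE : Prop where
  alloc_integrable : ∀ i,
    Integrable (fun v => (M.play (M.messages s v)).userAlloc B i) (profileLaw D n)
  pay_integrable : ∀ i, Integrable (fun v => M.totalPay B (M.messages s v) i) (profileLaw D n)
  burn_integrable : Integrable (fun v => (M.play (M.messages s v)).burnt B) (profileLaw D n)
  alloc_integrable_dev : ∀ i (m : M.Msg i),
    Integrable (fun v => (M.play (M.messagesWith s i m v)).userAlloc B i) (profileLaw D n)
  pay_integrable_dev : ∀ i (m : M.Msg i),
    Integrable (fun v => M.totalPay B (M.messagesWith s i m v) i) (profileLaw D n)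
  best_response : ∀ i, ∀ x ∈ D.support, ∀ m : M.Msg i,
    M.interimUtility B D s i x m ≤ M.interimUtility B D s i x (s i x)
  participation : ∀ i, ∀ x ∈ D.support, 0 ≤ M.interimUtility B D s i x (s i x)

/-- The miner's expected net revenue: all payments of the users, on-chain and off-chain, minus the
burn.  (On-chain payments of fabricated bids go from the miner to herself.) -/
def expectedRevenue : ℝ :=
  ∫ v, (∑ i, M.totalPay B (M.messages s v) i - (M.play (M.messages s v)).burnt B)
    ∂(profileLaw D n)

/-- Under `M` the equilibrium `s` maximizes the miner's expected net revenue over all off-chain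
mechanisms and all their Bayes-Nash equilibria. -/
def IsRevenueOptimal : Prop :=
  M.IsBNE B D s ∧
    ∀ (M' : OffChainMechanism Advice Bid n) (s' : ∀ i, ℝ → M'.Msg i), M'.IsBNE B D s' →
      M'.expectedRevenue B D s' ≤ M.expectedRevenue B D s

end OffChainMechanism

/-- `X` and `burn` are the value allocation rule and the value burn rule of a Myerson-in-Range
mechanism for the block-building process `B` and the distribution `D`: for every number of users
they arise, by the revelation principle, from a revenue-optimal equilibrium of the off-chain game. -/
def IsMyersonInRange (B : BlockBuildingProcess Advice Bid) (D : Measure ℝ)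
    (X : (n : ℕ) → (Fin n → ℝ) → Fin n → ℝ) (burn : (n : ℕ) → (Fin n → ℝ) → ℝ) : Prop :=
  ∀ n, ∃ (M : OffChainMechanism Advice Bid n) (s : ∀ i, ℝ → M.Msg i),
    M.IsRevenueOptimal B D s ∧
    (∀ v i, X n v i = (M.play (M.messages s v)).userAlloc B i) ∧
    (∀ v, burn n v = (M.play (M.messages s v)).burnt B)

/-! ### Gradients -/

/-- `g` is a subgradient of `U` at `y`. -/
def IsSubgradientAt (U : (Fin n → ℝ) → ℝ) (g y : Fin n → ℝ) : Prop :=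
  ∀ z, U y + ∑ i, g i * (z i - y i) ≤ U z

/-- `U` is differentiable at `y` with gradient `g`. -/
def IsGradientAt (U : (Fin n → ℝ) → ℝ) (g y : Fin n → ℝ) : Prop :=
  HasFDerivAt U (∑ i, g i • ContinuousLinearMap.proj (R := ℝ) (φ := fun _ : Fin n => ℝ) i) y

/-- The partial derivative of `U` in coordinate `i` exists at `y` and equals `c`. -/
def IsPartialDerivAt (U : (Fin n → ℝ) → ℝ) (i : Fin n) (c : ℝ) (y : Fin n → ℝ) : Prop :=
  HasDerivAt (fun t => U (Function.update y i t)) c (y i)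

end TFM

end

/-!
The function `U n y` of the theorem is `indirectUtility B n y`, the largest virtual surplus `∑ i,
y i * X i(p) - burn(p)` over all on-chain plays `p` of the miner and `n` users. It is finite,
because the miner could censor everybody and collect any possible negative burn, so an optimal
revenue bounds burns from below (`isBurnBounded_of_isRevenueOptimal`). As a supremum of affine
functions with slopes in `[0, 1]` it is convex, monotone and continuous. Censoring a user leaves
the outcome of everybody else unchanged, so only the positive parts of `y` matter; this gives the
vanishing partial derivatives and the invariance under adding users with non-positive virtual
values.

The remaining claims follow once the play of a revenue-optimal equilibrium is known to attain this
supremum at `φ(v)` for almost every `v` (`IsRegular.ae_surplus_eq_indirectUtility`): an affine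
function that touches a supremum of affine functions is a subgradient, and the equality of values
is the burn identity.

Optimality is Myerson's argument. In equilibrium the interim allocation `x` of a user is monotone
and the payments are given by the envelope theorem (`exists_isMonotoneAlloc`), so by Fubini the
expected payment on `[c, d]` is the expected virtual value of `x` up to boundary terms
(`IsRegular.integral_envelopePay`). Values need not have a finite mean, and then the boundary term
`(1 - F(d)) u(d)` need not vanish as `d → ∞`: for the equal-revenue distribution it is all of the
revenue. It is at most `d (1 - F(d)) σ` up to `o(1)`, where `σ` is the largest allocation that the
user can get, and `d (1 - F(d))` stays bounded (`IsRegular.mul_one_sub_cdf_le`). The competing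
mechanism therefore maximizes, over finitely many plays, the surplus for the positive virtual
values, raised by a large amount `H` above `d` (`cappedVirtualValue`, `surplusRule`). It is
truthful, its revenue contains nearly the same boundary term (`le_ruleAlloc_surplusRule`), and for
large `d` and large families of plays its virtual surplus approaches the expectation of `U n
(φ(v))`. Comparing revenues shows that `U n (φ(v))` has no larger expectation than the surplus of
the equilibrium (`IsRegular.integral_bestSurplus_le`).

For atomless virtual values, each partial derivative of the convex function `U n` exists almost
surely, since convex functions on the line are differentiable up to a countable set, and a convex
function with all partial derivatives at a point is differentiable there
(`IsSubgradientAt.isGradientAt_of_partial`). The law of `φ(v)` may be singular, so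
differentiability almost everywhere for Lebesgue measure would not be enough.
-/

noncomputable section

namespace TFM

open Filter Topology Set

/-! ### Virtual surplus and the indirect utility -/

section Surplus

variable {Advice : Type*} {Bid : Type*} {n : ℕ} (B : BlockBuildingProcess Advice Bid)

namespace OnChainPlay

lemma userAlloc_nonneg (p : OnChainPlay Advice Bid n) (i : Fin n) : 0 ≤ p.userAlloc B i := by
  unfold userAlloc
  cases p.slot i with
  | none => exact le_rfl
  | some k => exact (B.alloc_mem _ _ _ _).1

lemma userAlloc_le_one (p : OnChainPlay Advice Bid n) (i : Fin n) : p.userAlloc B i ≤ 1 := by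
  unfold userAlloc
  cases p.slot i with
  | none => exact zero_le_one
  | some k => exact (B.alloc_mem _ _ _ _).2

/-- The same bids and advice, but every user outside `keep` is censored: his bid stays in the list
as a fabricated one, so the burn and the outcome of all other users do not change. -/
def censor (p : OnChainPlay Advice Bid n) (keep : Set (Fin n)) : OnChainPlay Advice Bid n where
  advice := p.advice
  size := p.size
  bids := p.bids
  slot := fun i => open Classical in if i ∈ keep then p.slot i else none
  slot_inj := by
    intro i j k hi hj
    split_ifs at hi hj
    exact p.slot_inj i j k hi hj

lemma userAlloc_censor_of_mem (p : OnChainPlay Advice Bid n) {keep : Set (Fin n)} {i : Fin n}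
    (hi : i ∈ keep) : (p.censor keep).userAlloc B i = p.userAlloc B i := by
  simp [userAlloc, censor, hi]

lemma userAlloc_censor_of_notMem (p : OnChainPlay Advice Bid n) {keep : Set (Fin n)} {i : Fin n}
    (hi : i ∉ keep) : (p.censor keep).userAlloc B i = 0 := by
  simp [userAlloc, censor, hi]

@[simp] lemma burnt_censor (p : OnChainPlay Advice Bid n) (keep : Set (Fin n)) :
    (p.censor keep).burnt B = p.burnt B := rfl

/-- A play of `n + t` users, seen as a play of the first `n` users only. -/
def firstUsers {t : ℕ} (p : OnChainPlay Advice Bid (n + t)) : OnChainPlay Advice Bid n where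
  advice := p.advice
  size := p.size
  bids := p.bids
  slot := fun i => p.slot (Fin.castAdd t i)
  slot_inj := fun _ _ k hi hj => Fin.castAdd_injective n t (p.slot_inj _ _ k hi hj)

/-- A play of `n` users, seen as a play of `n + t` users of whom the last `t` are censored. -/
def addCensored (p : OnChainPlay Advice Bid n) (t : ℕ) : OnChainPlay Advice Bid (n + t) where
  advice := p.advice
  size := p.size
  bids := p.bids
  slot := Fin.append p.slot (fun _ => none)
  slot_inj := by
    intro i j k hi hj
    induction i using Fin.addCases with
    | right i => simp at hi
    | left i =>
      induction j using Fin.addCases with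
      | right j => simp at hj
      | left j =>
        simp only [Fin.append_left] at hi hj
        rw [p.slot_inj i j k hi hj]

/-- The virtual surplus `∑ i, y i * X i - burn` of a play at the virtual values `y`. -/
def surplus (p : OnChainPlay Advice Bid n) (y : Fin n → ℝ) : ℝ :=
  ∑ i, y i * p.userAlloc B i - p.burnt B

/-- Censoring the users with non-positive virtual values replaces these values by zero. -/
lemma surplus_censor_pos (p : OnChainPlay Advice Bid n) (y : Fin n → ℝ) :
    (p.censor {i | 0 < y i}).surplus B y = p.surplus B (fun i => max (y i) 0) := by
  unfold surplus
  congr 1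
  refine Finset.sum_congr rfl fun i _ => ?_
  beta_reduce
  by_cases hi : 0 < y i
  · rw [userAlloc_censor_of_mem B p (by exact hi), max_eq_left hi.le]
  · rw [userAlloc_censor_of_notMem B p (by exact hi), max_eq_right (not_lt.1 hi)]
    simp

lemma surplus_mono (p : OnChainPlay Advice Bid n) {y z : Fin n → ℝ} (h : y ≤ z) :
    p.surplus B y ≤ p.surplus B z :=
  sub_le_sub_right (Finset.sum_le_sum fun i _ =>
    mul_le_mul_of_nonneg_right (h i) (p.userAlloc_nonneg B i)) _

lemma surplus_sub (p : OnChainPlay Advice Bid n) (y z : Fin n → ℝ) :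
    p.surplus B z - p.surplus B y = ∑ i, p.userAlloc B i * (z i - y i) := by
  simp only [surplus, sub_sub_sub_cancel_right, ← Finset.sum_sub_distrib]
  exact Finset.sum_congr rfl fun i _ => by ring

lemma surplus_le_sum_max (p : OnChainPlay Advice Bid n) (y : Fin n → ℝ) :
    p.surplus B y ≤ ∑ i, max (y i) 0 - p.burnt B := by
  refine sub_le_sub_right (Finset.sum_le_sum fun i _ => ?_) _
  calc y i * p.userAlloc B i ≤ max (y i) 0 * p.userAlloc B i :=
        mul_le_mul_of_nonneg_right (le_max_left _ _) (p.userAlloc_nonneg B i)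
    _ ≤ max (y i) 0 * 1 :=
        mul_le_mul_of_nonneg_left (p.userAlloc_le_one B i) (le_max_right _ _)
    _ = _ := mul_one _

lemma continuous_surplus (p : OnChainPlay Advice Bid n) : Continuous (p.surplus B) := by
  unfold surplus
  fun_prop

end OnChainPlay

/-- The miner can play, and no play has an arbitrarily negative burn. -/
structure IsBurnBounded (n : ℕ) : Prop where
  nonempty : Nonempty (OnChainPlay Advice Bid n)
  bddBelow : BddBelow (range fun p : OnChainPlay Advice Bid n => p.burnt B)

/-- The largest virtual surplus `sup_p (∑ i, y i * X i(p) - burn(p))` over all on-chain plays `p`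
of the miner and `n` users.  It is meaningful when burns are bounded below: the supremum of an
unbounded set of reals is zero by convention. -/
def indirectUtility (n : ℕ) (y : Fin n → ℝ) : ℝ :=
  ⨆ p : OnChainPlay Advice Bid n, p.surplus B y

variable {B}

namespace IsBurnBounded

variable (hB : IsBurnBounded B n)

include hB

lemma bddAbove_surplus (y : Fin n → ℝ) :
    BddAbove (range fun p : OnChainPlay Advice Bid n => p.surplus B y) := by
  obtain ⟨b, hb⟩ := hB.bddBelow
  refine ⟨∑ i, max (y i) 0 - b, ?_⟩
  rintro _ ⟨p, rfl⟩
  exact (p.surplus_le_sum_max B y).trans (sub_le_sub_left (hb ⟨p, rfl⟩) _)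

lemma surplus_le (p : OnChainPlay Advice Bid n) (y : Fin n → ℝ) :
    p.surplus B y ≤ indirectUtility B n y :=
  le_ciSup (hB.bddAbove_surplus y) p

lemma indirectUtility_le {y : Fin n → ℝ} {a : ℝ}
    (h : ∀ p : OnChainPlay Advice Bid n, p.surplus B y ≤ a) : indirectUtility B n y ≤ a := by
  have := hB.nonempty
  exact ciSup_le h

lemma monotone_indirectUtility : Monotone (indirectUtility B n) := fun _ z h =>
  hB.indirectUtility_le fun p => (p.surplus_mono B h).trans (hB.surplus_le p z)

lemma convexOn_indirectUtility : ConvexOn ℝ univ (indirectUtility B n) := by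
  refine ⟨convex_univ, fun y _ z _ a b ha hb hab => hB.indirectUtility_le fun p => ?_⟩
  have h : p.surplus B (a • y + b • z) = a • p.surplus B y + b • p.surplus B z := by
    simp only [OnChainPlay.surplus, Pi.add_apply, Pi.smul_apply, smul_eq_mul, mul_sub,
      Finset.mul_sum]
    have : p.burnt B = a * p.burnt B + b * p.burnt B := by rw [← add_mul, hab, one_mul]
    rw [sub_add_sub_comm, ← this, ← Finset.sum_add_distrib]
    congr 1
    exact Finset.sum_congr rfl fun i _ => by ring
  rw [h]
  exact add_le_add (smul_le_smul_of_nonneg_left (hB.surplus_le p y) ha)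
    (smul_le_smul_of_nonneg_left (hB.surplus_le p z) hb)

/-- Users with negative virtual values can be censored, so only positive parts matter. -/
lemma indirectUtility_max_zero (y : Fin n → ℝ) :
    indirectUtility B n (fun i => max (y i) 0) = indirectUtility B n y := by
  refine le_antisymm (hB.indirectUtility_le fun p => ?_)
    (hB.monotone_indirectUtility fun i => le_max_left _ _)
  rw [← p.surplus_censor_pos B y]
  exact hB.surplus_le _ y

lemma indirectUtility_le_sub_add (y z : Fin n → ℝ) :
    indirectUtility B n z ≤ indirectUtility B n y + ∑ i, |z i - y i| := by
  refine hB.indirectUtility_le fun p => ?_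
  have h := p.surplus_sub B y z
  have h2 : ∑ i, p.userAlloc B i * (z i - y i) ≤ ∑ i, |z i - y i| := by
    refine Finset.sum_le_sum fun i _ => ?_
    calc p.userAlloc B i * (z i - y i) ≤ p.userAlloc B i * |z i - y i| :=
          mul_le_mul_of_nonneg_left (le_abs_self _) (p.userAlloc_nonneg B i)
      _ ≤ 1 * |z i - y i| :=
          mul_le_mul_of_nonneg_right (p.userAlloc_le_one B i) (abs_nonneg _)
      _ = _ := one_mul _
  linarith [hB.surplus_le p y]

lemma continuous_indirectUtility : Continuous (indirectUtility B n) := by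
  rw [continuous_iff_continuousAt]
  intro y
  have hc : Tendsto (fun z : Fin n → ℝ => ∑ i, |z i - y i|) (𝓝 y) (𝓝 0) := by
    have : Continuous fun z : Fin n → ℝ => ∑ i, |z i - y i| := by fun_prop
    simpa using this.tendsto y
  refine tendsto_iff_dist_tendsto_zero.2 (squeeze_zero (fun _ => dist_nonneg) (fun z => ?_) hc)
  rw [Real.dist_eq, abs_sub_le_iff]
  refine ⟨by linarith [hB.indirectUtility_le_sub_add y z], ?_⟩
  have := hB.indirectUtility_le_sub_add z y
  simp only [fun i => abs_sub_comm (y i) (z i)] at this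
  linarith

/-- The indirect utility does not depend on a coordinate while this coordinate is negative. -/
lemma isPartialDerivAt_zero {y : Fin n → ℝ} {i : Fin n} (hi : y i < 0) :
    IsPartialDerivAt (indirectUtility B n) i 0 y := by
  refine (hasDerivAt_const (y i) (indirectUtility B n y)).congr_of_eventuallyEq ?_
  filter_upwards [eventually_lt_nhds hi] with t ht
  rw [← hB.indirectUtility_max_zero, ← hB.indirectUtility_max_zero y]
  congr 1
  ext j
  rcases eq_or_ne j i with rfl | hj
  · rw [Function.update_self, max_eq_right ht.le, max_eq_right hi.le]
  · rw [Function.update_of_ne hj]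

end IsBurnBounded

lemma indirectUtility_add {t : ℕ} (hB : IsBurnBounded B n) (hB' : IsBurnBounded B (n + t))
    (y : Fin (n + t) → ℝ) (hy : ∀ k : Fin t, y (Fin.natAdd n k) ≤ 0) :
    indirectUtility B (n + t) y = indirectUtility B n (fun i => y (Fin.castAdd t i)) := by
  refine le_antisymm (hB'.indirectUtility_le fun p => ?_) (hB.indirectUtility_le fun p => ?_)
  · refine le_trans ?_ (hB.surplus_le p.firstUsers _)
    unfold OnChainPlay.surplus
    rw [Fin.sum_univ_add]
    have : ∑ k : Fin t, y (Fin.natAdd n k) * p.userAlloc B (Fin.natAdd n k) ≤ 0 :=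
      Finset.sum_nonpos fun k _ =>
        mul_nonpos_of_nonpos_of_nonneg (hy k) (p.userAlloc_nonneg B _)
    have h2 : p.firstUsers.burnt B = p.burnt B := rfl
    have h3 : ∀ i, p.firstUsers.userAlloc B i = p.userAlloc B (Fin.castAdd t i) := fun i => rfl
    simp only [h2, h3]
    linarith
  · refine le_trans (le_of_eq ?_) (hB'.surplus_le (p.addCensored t) _)
    unfold OnChainPlay.surplus
    rw [Fin.sum_univ_add]
    have h2 : (p.addCensored t).burnt B = p.burnt B := rfl
    have h3 : ∀ i, (p.addCensored t).userAlloc B (Fin.castAdd t i) = p.userAlloc B i := by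
      intro i
      simp [OnChainPlay.userAlloc, OnChainPlay.addCensored]
    have h4 : ∀ i, (p.addCensored t).userAlloc B (Fin.natAdd n i) = 0 := by
      intro i
      simp [OnChainPlay.userAlloc, OnChainPlay.addCensored]
    simp [h2, h3, h4]

variable (B) in
/-- The outcomes (allocation and burn) of the plays `q k` are dense among the outcomes of all plays,
stated for continuous functionals of the outcome: a value above `a` that is attained by some play is
also attained along `q`. -/
def HasDenseOutcomes (q : ℕ → OnChainPlay Advice Bid n) : Prop :=
  ∀ (h : (Fin n → ℝ) × ℝ → ℝ), Continuous h →
    ∀ (p : OnChainPlay Advice Bid n) (a : ℝ), a < h (p.userAlloc B, p.burnt B) →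
      ∃ k, a < h ((q k).userAlloc B, (q k).burnt B)

lemma exists_hasDenseOutcomes [Nonempty (OnChainPlay Advice Bid n)] :
    ∃ q : ℕ → OnChainPlay Advice Bid n, HasDenseOutcomes B q := by
  set A : Set ((Fin n → ℝ) × ℝ) :=
    range fun p : OnChainPlay Advice Bid n => (p.userAlloc B, p.burnt B) with hA
  have hne : Nonempty A := (range_nonempty _).to_subtype
  have hq : ∀ k : ℕ, ∃ p : OnChainPlay Advice Bid n,
      (p.userAlloc B, p.burnt B) = (TopologicalSpace.denseSeq A k : (Fin n → ℝ) × ℝ) :=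
    fun k => (TopologicalSpace.denseSeq A k).2
  choose q hq using hq
  refine ⟨q, fun h hh p a ha => ?_⟩
  have hopen : IsOpen {x : A | a < h x} := 
    isOpen_lt continuous_const (hh.comp continuous_subtype_val)
  obtain ⟨k, hk⟩ := (TopologicalSpace.denseRange_denseSeq A).exists_mem_open hopen
    ⟨⟨_, p, rfl⟩, ha⟩
  refine ⟨k, ?_⟩
  rw [hq k]
  exact hk

end Surplus

/-! ### Regular distributions -/

section Distribution

variable {D : Measure ℝ} {f : ℝ → ℝ}

lemma virtualValue_of_cdf_eq_one {v : ℝ} (hv : cdf D v = 1) : virtualValue D f v = v := by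
  simp [virtualValue, hv]

namespace IsRegular

variable (hreg : IsRegular D f)

include hreg

lemma measurable_virtualValue : Measurable (virtualValue D f) := by
  have h1 : Measurable (cdf D) := (monotone_cdf D).measurable
  have h2 := hreg.measurable_density
  unfold virtualValue
  fun_prop

lemma virtualValue_le (v : ℝ) : virtualValue D f v ≤ v := by
  unfold virtualValue
  have := div_nonneg (sub_nonneg.2 (cdf_le_one D v)) (hreg.density_nonneg v)
  linarith

lemma mem_support_of_cdf_pos {v : ℝ} (h0 : 0 < cdf D v) (h1 : cdf D v < 1) : v ∈ D.support := by
  have := hreg.prob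
  rw [Measure.mem_support_iff_forall]
  intro V hV
  -- the density is positive on an interval to the right of `v`
  have hright : ∀ᶠ w in 𝓝[≥] v, cdf D w < 1 :=
    ((cdf D).right_continuous v).eventually (gt_mem_nhds h1)
  obtain ⟨b, hvb, hb⟩ := mem_nhdsGE_iff_exists_Ico_subset.1
    (inter_mem hright (mem_nhdsWithin_of_mem_nhds hV))
  have hIco : Ico v b ⊆ {w | cdf D w < 1} := fun w hw => (hb hw).1
  have hD : D (Ico v b) = (volume.withDensity fun v => ENNReal.ofReal (f v)) (Ico v b) := by
    have := congrArg (fun m => m (Ico v b)) hreg.hasDensity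
    simpa [Measure.restrict_apply measurableSet_Ico, inter_eq_left.2 hIco] using this
  refine lt_of_lt_of_le ?_ (measure_mono fun w hw => (hb hw).2)
  rw [hD, withDensity_apply _ measurableSet_Ico, setLIntegral_pos_iff]
  · have : Function.support (fun v => ENNReal.ofReal (f v)) ∩ Ico v b = Ico v b := by
      refine inter_eq_right.2 fun w hw => ?_
      have := hreg.density_pos w (h0.trans_le (monotone_cdf D hw.1)) (hIco hw)
      simpa using this
    rw [this]
    simpa using hvb
  · exact hreg.measurable_density.ennreal_ofReal

lemma virtualValue_mono {v w : ℝ} (hv : 0 < cdf D v) (hvw : v ≤ w) :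
    virtualValue D f v ≤ virtualValue D f w := by
  rcases (cdf_le_one D w).lt_or_eq with h | h
  · have hw := hv.trans_le (monotone_cdf D hvw)
    have h' := (monotone_cdf D hvw).trans_lt h
    exact hreg.mono ⟨hreg.mem_support_of_cdf_pos hv h', Or.inl (hreg.density_pos v hv h')⟩
      ⟨hreg.mem_support_of_cdf_pos hw h, Or.inl (hreg.density_pos w hw h)⟩ hvw
  · rw [virtualValue_of_cdf_eq_one h]
    exact (hreg.virtualValue_le v).trans hvw

lemma measure_singleton_eq_zero {v : ℝ} (hv : cdf D v < 1) : D {v} = 0 := by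
  have h := congrArg (fun m => m {v}) hreg.hasDensity
  simp only [Measure.restrict_apply (measurableSet_singleton v)] at h
  have h2 : ({v} : Set ℝ) ∩ {v | cdf D v < 1} = {v} := inter_eq_left.2 (by simpa using hv)
  rw [h2] at h
  rw [h]
  exact withDensity_absolutelyContinuous _ _ (measure_singleton v)

lemma ae_mem_support_and_cdf_pos : ∀ᵐ v ∂D, v ∈ D.support ∧ 0 < cdf D v := by
  have := hreg.prob
  have hs : ∀ᵐ v ∂D, v ∈ D.support := Measure.support_mem_ae
  have hsub : {v | v ∈ D.support ∧ cdf D v = 0}.Subsingleton := by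
    -- below any point to the right of a support point there is positive mass
    have key : ∀ v w, v ∈ D.support → v < w → cdf D w ≠ 0 := by
      intro v w hv hvw hw
      have h1 := (Measure.mem_support_iff_forall v).1 hv (Iic w) (Iic_mem_nhds hvw)
      rw [← ofReal_cdf, hw] at h1
      simp at h1
    intro v hv w hw
    by_contra hne
    rcases lt_or_gt_of_ne hne with h | h
    · exact key v w hv.1 h hw.2
    · exact key w v hw.1 h hv.2
  have hz : D {v | v ∈ D.support ∧ cdf D v = 0} = 0 := by
    rcases hsub.eq_empty_or_singleton with h | ⟨a, h⟩
    · simp [h]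
    · rw [h]
      have ha : cdf D a = 0 := (h.symm.subset rfl : a ∈ {v | v ∈ D.support ∧ cdf D v = 0}).2
      refine measure_mono_null (singleton_subset_iff.2 self_mem_Iic) ?_
      rw [← ofReal_cdf, ha, ENNReal.ofReal_zero]
  have hz' : ∀ᵐ v ∂D, ¬(v ∈ D.support ∧ cdf D v = 0) := measure_eq_zero_iff_ae_notMem.1 hz
  filter_upwards [hs, hz'] with v h1 h2
  exact ⟨h1, (cdf_nonneg D v).lt_of_ne fun h => h2 ⟨h1, h.symm⟩⟩

lemma integrableOn_mul_virtualValue {x : ℝ → ℝ} (hx : Measurable x) {C : ℝ} (hC : ∀ v, |x v| ≤ C)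
    {c d : ℝ} (hc : 0 < cdf D c) :
    IntegrableOn (fun v => x v * virtualValue D f v) (Icc c d) D := by
  have := hreg.prob
  refine Integrable.of_bound (hx.mul hreg.measurable_virtualValue).aestronglyMeasurable
    (C * (|virtualValue D f c| + |d|)) ?_
  filter_upwards [ae_restrict_mem measurableSet_Icc] with v hv
  rw [norm_mul]
  have h1 := hreg.virtualValue_mono hc hv.1
  have h2 := (hreg.virtualValue_le v).trans hv.2
  refine mul_le_mul (hC v) ?_ (abs_nonneg _) ((abs_nonneg _).trans (hC v))
  rw [Real.norm_eq_abs, abs_le]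
  constructor
  · linarith [neg_abs_le (virtualValue D f c), abs_nonneg d]
  · linarith [le_abs_self d, abs_nonneg (virtualValue D f c)]

/-- The definition of the virtual value, `(1 - F) dv = (v - φ(v)) dF(v)`, integrated against a
bounded function. -/
lemma intervalIntegral_mul_one_sub_cdf (x : ℝ → ℝ) {c d : ℝ} (hc : 0 < cdf D c) (hcd : c ≤ d) :
    ∫ z in c..d, x z * (1 - cdf D z) = ∫ v in Icc c d, x v * (v - virtualValue D f v) ∂D := by
  have := hreg.prob
  set S : Set ℝ := {v | cdf D v < 1} with hS
  have hSm : MeasurableSet S := measurableSet_lt (monotone_cdf D).measurable measurable_const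
  have hone : ∀ z, z ∉ S → cdf D z = 1 := fun z hz => le_antisymm (cdf_le_one D z) (not_lt.1 hz)
  rw [intervalIntegral.integral_of_le hcd]
  have h2 : ∫ z in Ioc c d, x z * (1 - cdf D z) = ∫ z in Ioc c d ∩ S, x z * (1 - cdf D z) := by
    refine setIntegral_eq_of_subset_of_forall_sdiff_eq_zero measurableSet_Ioc inter_subset_left
      fun z hz => ?_
    rw [hone z fun h => hz.2 ⟨hz.1, h⟩]
    ring
  have h3 : ∫ v in Icc c d, x v * (v - virtualValue D f v) ∂D
      = ∫ v in Ioc c d ∩ S, x v * (v - virtualValue D f v) ∂D := by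
    refine setIntegral_eq_of_subset_of_ae_sdiff_eq_zero measurableSet_Icc.nullMeasurableSet
      (inter_subset_left.trans Ioc_subset_Icc_self) ?_
    -- the only possible atom of `D` is the top of the support, where `φ(v) = v`
    have hc' : ∀ᵐ v ∂D, v = c → cdf D c = 1 := by
      rcases (cdf_le_one D c).lt_or_eq with h | h
      · have := measure_eq_zero_iff_ae_notMem.1 (hreg.measure_singleton_eq_zero h)
        filter_upwards [this] with v hv hvc
        exact absurd hvc hv
      · exact Eventually.of_forall fun _ _ => h
    filter_upwards [hc'] with z hzc hz
    have hz1 : cdf D z = 1 := by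
      rcases hz.1.1.eq_or_lt with h | h
      · rw [← h]
        exact hzc h.symm
      · exact hone z fun hS => hz.2 ⟨⟨h, hz.1.2⟩, hS⟩
    rw [virtualValue_of_cdf_eq_one hz1]
    ring
  have hdens : D.restrict (Ioc c d ∩ S)
      = (volume.withDensity fun v => ENNReal.ofReal (f v)).restrict (Ioc c d ∩ S) := by
    rw [← Measure.restrict_restrict measurableSet_Ioc, hreg.hasDensity,
      Measure.restrict_restrict measurableSet_Ioc]
  rw [h2, h3, hdens, setIntegral_withDensity_eq_setIntegral_toReal_smul
    hreg.measurable_density.ennreal_ofReal (by simp) _ (measurableSet_Ioc.inter hSm)]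
  refine setIntegral_congr_fun (measurableSet_Ioc.inter hSm) fun z hz => ?_
  have hf := hreg.density_pos z (hc.trans_le (monotone_cdf D hz.1.1.le)) hz.2
  simp only [ENNReal.toReal_ofReal hf.le, smul_eq_mul, virtualValue]
  field_simp
  ring

end IsRegular

/-- Fubini: the expectation of `∫_c^{min v d} x` over `v ≥ c` weighs `x z` with the probability
of a value above `z`. -/
lemma integral_intervalIntegral_min [IsProbabilityMeasure D] {x : ℝ → ℝ} (hx : Measurable x)
    {C : ℝ} (hC : ∀ v, |x v| ≤ C) {c d : ℝ} (hcd : c ≤ d) :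
    ∫ v in Ici c, (∫ z in c..min v d, x z) ∂D = ∫ z in c..d, x z * (1 - cdf D z) := by
  set g : ℝ → ℝ → ℝ := fun v z => {p : ℝ × ℝ | p.2 < p.1}.indicator (fun p => x p.2) (v, z) with hg
  have hmeas : MeasurableSet {p : ℝ × ℝ | p.2 < p.1} :=
    measurableSet_lt measurable_snd measurable_fst
  have h1 : ∀ v ∈ Ici c, ∫ z in c..min v d, x z = ∫ z in Ioc c d, g v z := by
    intro v hv
    rw [intervalIntegral.integral_of_le (le_min hv hcd), integral_Ioc_eq_integral_Ioo]
    have : ∀ z, g v z = (Iio v).indicator x z := fun z => rfl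
    simp only [this]
    rw [setIntegral_indicator measurableSet_Iio]
    rcases le_total v d with h | h
    · rw [min_eq_left h]
      congr 2
      ext z
      simp only [mem_Ioo, mem_inter_iff, mem_Ioc, mem_Iio]
      constructor
      · rintro ⟨h1, h2⟩
        exact ⟨⟨h1, (h2.trans_le h).le⟩, h2⟩
      · rintro ⟨⟨h1, _⟩, h2⟩
        exact ⟨h1, h2⟩
    · rw [min_eq_right h, ← integral_Ioc_eq_integral_Ioo]
      refine setIntegral_congr_set ?_
      have : Ioo c d =ᵐ[volume] Ioc c d := Ioo_ae_eq_Ioc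
      refine EventuallyLE.antisymm ?_ (LE.le.eventuallyLE inter_subset_left)
      refine this.symm.le.trans (LE.le.eventuallyLE fun z hz => ?_)
      exact ⟨⟨hz.1, hz.2.le⟩, hz.2.trans_le h⟩
  rw [setIntegral_congr_fun measurableSet_Ici h1, integral_integral_swap,
    intervalIntegral.integral_of_le hcd]
  · refine setIntegral_congr_fun measurableSet_Ioc fun z hz => ?_
    have : ∀ v, g v z = (Ioi z).indicator (fun _ => x z) v := fun v => rfl
    simp only [this]
    rw [setIntegral_indicator measurableSet_Ioi, setIntegral_const, smul_eq_mul, mul_comm,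
      inter_eq_right.2 (Ioi_subset_Ici hz.1.le), ← compl_Iic, probReal_compl_eq_one_sub
      measurableSet_Iic, cdf_eq_real]
  · refine Integrable.of_bound ((hx.comp measurable_snd).indicator hmeas).aestronglyMeasurable C
      (Eventually.of_forall fun p => ?_)
    exact (norm_indicator_le_norm_self (fun p : ℝ × ℝ => x p.2) p).trans (hC _)

end Distribution

/-! ### The payment identity for a single agent -/

section Envelope

/-- A non-decreasing function with values in `[0, 1]`: the probability of being allocated that a
truthful mechanism offers to an agent, as a function of his value. -/
structure IsMonotoneAlloc (x : ℝ → ℝ) : Prop where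
  mono : Monotone x
  nonneg : ∀ v, 0 ≤ x v
  le_one : ∀ v, x v ≤ 1

/-- The utility of an agent with value `v` in a truthful mechanism with allocation function `x`:
by the envelope theorem it is determined by its value `u₀` at the point `r`. -/
def envelopeUtility (r u₀ : ℝ) (x : ℝ → ℝ) (v : ℝ) : ℝ := u₀ + ∫ z in r..v, x z

/-- The payment that goes with `envelopeUtility`. -/
def envelopePay (r u₀ : ℝ) (x : ℝ → ℝ) (v : ℝ) : ℝ := v * x v - envelopeUtility r u₀ x v

namespace IsMonotoneAlloc

variable {x : ℝ → ℝ} (hx : IsMonotoneAlloc x)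

include hx

lemma abs_le_one (v : ℝ) : |x v| ≤ 1 := abs_le.2 ⟨by linarith [hx.nonneg v], hx.le_one v⟩

lemma intervalIntegrable (a b : ℝ) : IntervalIntegrable x volume a b := hx.mono.intervalIntegrable

lemma envelopeUtility_sub (r u₀ v w : ℝ) :
    envelopeUtility r u₀ x w - envelopeUtility r u₀ x v = ∫ z in v..w, x z := by
  unfold envelopeUtility
  rw [← intervalIntegral.integral_add_adjacent_intervals (hx.intervalIntegrable r v)
    (hx.intervalIntegrable v w)]
  ring

lemma mul_le_intervalIntegral (v w : ℝ) : (w - v) * x v ≤ ∫ z in v..w, x z := by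
  rcases le_total v w with h | h
  · have := intervalIntegral.integral_mono_on h (intervalIntegrable_const (c := x v))
      (hx.intervalIntegrable v w) fun z hz => hx.mono hz.1
    simpa using this
  · rw [intervalIntegral.integral_symm]
    have := intervalIntegral.integral_mono_on h (hx.intervalIntegrable w v)
      (intervalIntegrable_const (c := x v)) fun z hz => hx.mono hz.2
    simp at this
    linarith

lemma monotone_envelopeUtility (r u₀ : ℝ) : Monotone (envelopeUtility r u₀ x) := by
  intro v w h
  have h1 := hx.envelopeUtility_sub r u₀ v w
  have h2 := hx.mul_le_intervalIntegral v w
  have h3 := mul_nonneg (sub_nonneg.2 h) (hx.nonneg v)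
  linarith

lemma measurable_envelopePay (r u₀ : ℝ) : Measurable (envelopePay r u₀ x) :=
  (measurable_id.mul hx.mono.measurable).sub (hx.monotone_envelopeUtility r u₀).measurable

end IsMonotoneAlloc

variable {D : Measure ℝ} {f : ℝ → ℝ} {x : ℝ → ℝ} {r u₀ : ℝ}

namespace IsRegular

variable (hreg : IsRegular D f)

include hreg

/-- **Payment identity.** On an interval `[c, d]` the expected payment is the expected virtual
value of the allocation, plus a boundary term for the values above `d`, minus one for the utility at
`c`.  For distributions with heavy tails the boundary term at `d` need not tend to zero. -/
lemma integral_envelopePay (hx : IsMonotoneAlloc x) {c d : ℝ} (hc : 0 < cdf D c) (hcd : c ≤ d) :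
    ∫ v in Icc c d, envelopePay r u₀ x v ∂D =
      ∫ v in Icc c d, virtualValue D f v * x v ∂D
        + (1 - cdf D d) * envelopeUtility r u₀ x d - D.real (Ici c) * envelopeUtility r u₀ x c := by
  have := hreg.prob
  set u := envelopeUtility r u₀ x with hu
  have hmono := hx.monotone_envelopeUtility r u₀
  have hxm := hx.mono.measurable
  have hbound : ∀ g : ℝ → ℝ, Measurable g → (∃ C, ∀ v ∈ Icc c d, |g v| ≤ C) →
      IntegrableOn g (Icc c d) D := by
    rintro g hg ⟨C, hC⟩
    refine Integrable.of_bound hg.aestronglyMeasurable C ?_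
    filter_upwards [ae_restrict_mem measurableSet_Icc] with v hv using hC v hv
  have hui : IntegrableOn u (Icc c d) D := by
    refine hbound u hmono.measurable ⟨|u c| + |u d|, fun v hv => abs_le.2 ⟨?_, ?_⟩⟩
    · linarith [hmono hv.1, neg_abs_le (u c), abs_nonneg (u d)]
    · linarith [hmono hv.2, le_abs_self (u d), abs_nonneg (u c)]
  have hvi : IntegrableOn (fun v => v * x v) (Icc c d) D := by
    refine hbound _ (measurable_id.mul hxm) ⟨(|c| + |d|) * 1, fun v hv => ?_⟩
    rw [abs_mul]
    refine mul_le_mul (abs_le.2 ⟨?_, ?_⟩) (hx.abs_le_one v) (abs_nonneg _) (by positivity)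
    · linarith [hv.1, neg_abs_le c, abs_nonneg d]
    · linarith [hv.2, le_abs_self d, abs_nonneg c]
  have hφi := hreg.integrableOn_mul_virtualValue (d := d) hxm hx.abs_le_one hc
  have hF := integral_intervalIntegral_min (D := D) hxm hx.abs_le_one hcd
  rw [hreg.intervalIntegral_mul_one_sub_cdf x hc hcd] at hF
  -- the left side of Fubini's identity in terms of the utility
  have hL : ∫ v in Ici c, (∫ z in c..min v d, x z) ∂D
      = ∫ v in Icc c d, u v ∂D + (1 - cdf D d) * u d - D.real (Ici c) * u c := by
    have hIoi : D.real (Ioi d) = 1 - cdf D d := by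
      rw [← compl_Iic, probReal_compl_eq_one_sub measurableSet_Iic, cdf_eq_real]
    have hun : Icc c d ∪ Ioi d = Ici c := Icc_union_Ioi_eq_Ici hcd
    have hdis : Disjoint (Icc c d) (Ioi d) :=
      disjoint_left.2 fun v h1 h2 => (not_lt.2 h1.2) h2
    have hsum : D.real (Ici c) = D.real (Icc c d) + D.real (Ioi d) := by
      rw [← hun, measureReal_union hdis measurableSet_Ioi]
    have e : ∀ v, ∫ z in c..min v d, x z = u (min v d) - u c := fun v =>
      (hx.envelopeUtility_sub r u₀ _ _).symm
    simp only [e]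
    have e1 : ∀ v ∈ Icc c d, u (min v d) - u c = u v - u c := fun v hv => by
      rw [min_eq_left hv.2]
    have e2 : ∀ v ∈ Ioi d, u (min v d) - u c = u d - u c := fun v hv => by
      rw [min_eq_right (le_of_lt hv)]
    rw [← hun, setIntegral_union hdis measurableSet_Ioi,
      setIntegral_congr_fun measurableSet_Icc e1, setIntegral_congr_fun measurableSet_Ioi e2,
      integral_sub hui (integrable_const _), setIntegral_const, setIntegral_const, hun, hsum,
      ← hIoi]
    · simp only [smul_eq_mul]
      ring
    · exact (hui.sub (integrable_const _)).congr_fun (fun v hv => (e1 v hv).symm) measurableSet_Icc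
    · exact (integrable_const (u d - u c)).congr
        ((ae_restrict_mem measurableSet_Ioi).mono fun v hv => (e2 v hv).symm)
  rw [hL] at hF
  have hR : ∫ v in Icc c d, x v * (v - virtualValue D f v) ∂D
      = ∫ v in Icc c d, v * x v ∂D - ∫ v in Icc c d, virtualValue D f v * x v ∂D := by
    rw [← integral_sub hvi (by simpa only [IntegrableOn, mul_comm] using hφi)]
    exact integral_congr_ae (Eventually.of_forall fun v => by ring)
  have hP : ∫ v in Icc c d, envelopePay r u₀ x v ∂D
      = ∫ v in Icc c d, v * x v ∂D - ∫ v in Icc c d, u v ∂D :=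
    integral_sub hvi hui
  rw [hR] at hF
  rw [hP]
  linarith

/-- The payment identity for the mechanism that always allocates for free. -/
lemma integral_virtualValue_Icc {c d : ℝ} (hc : 0 < cdf D c) (hcd : c ≤ d) :
    ∫ v in Icc c d, virtualValue D f v ∂D = c * D.real (Ici c) - d * (1 - cdf D d) := by
  have h := hreg.integral_envelopePay (x := fun _ => 1) (r := 0) (u₀ := 0)
    ⟨monotone_const, fun _ => zero_le_one, fun _ => le_rfl⟩ hc hcd
  simp [envelopePay, envelopeUtility] at h
  linarith

lemma integrableOn_virtualValue_Ici {c : ℝ} (hc : 0 < cdf D c) :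
    IntegrableOn (virtualValue D f) (Ici c) D := by
  have := hreg.prob
  have hIcc : ∀ d : ℝ, IntegrableOn (virtualValue D f) (Icc c d) D := fun d => by
    simpa using hreg.integrableOn_mul_virtualValue (x := fun _ => 1) (d := d) measurable_const
      (C := 1) (by simp) hc
  refine (aecover_Iic (tendsto_natCast_atTop_atTop (R := ℝ))).integrable_of_integral_norm_bounded
    (|c| + 2 * |virtualValue D f c|) (fun k => ?_) ?_
  · rw [IntegrableOn, Measure.restrict_restrict measurableSet_Iic, inter_comm, Ici_inter_Iic]
    exact hIcc _
  · filter_upwards [eventually_ge_atTop ⌈max c 0⌉₊] with k hk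
    have hk' := Nat.ceil_le.1 hk
    rw [Measure.restrict_restrict measurableSet_Iic, inter_comm, Ici_inter_Iic]
    have h1 : ∫ v in Icc c (k : ℝ), ‖virtualValue D f v‖ ∂D
        ≤ ∫ v in Icc c (k : ℝ), (virtualValue D f v + 2 * |virtualValue D f c|) ∂D := by
      refine setIntegral_mono_on (hIcc _).norm ((hIcc _).add (integrable_const _))
        measurableSet_Icc fun v hv => abs_le.2 ⟨?_, ?_⟩
      · linarith [hreg.virtualValue_mono hc hv.1, neg_abs_le (virtualValue D f c)]
      · linarith [abs_nonneg (virtualValue D f c)]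
    rw [integral_add (hIcc _) (integrable_const _), hreg.integral_virtualValue_Icc hc
      ((le_max_left _ _).trans hk'), setIntegral_const, smul_eq_mul] at h1
    have h2 : c * D.real (Ici c) ≤ |c| * 1 :=
      mul_le_mul (le_abs_self c) measureReal_le_one measureReal_nonneg (abs_nonneg c)
    have h3 : 0 ≤ (k : ℝ) * (1 - cdf D k) :=
      mul_nonneg (Nat.cast_nonneg _) (sub_nonneg.2 (cdf_le_one D _))
    have h4 : D.real (Icc c (k : ℝ)) * (2 * |virtualValue D f c|)
        ≤ 1 * (2 * |virtualValue D f c|) :=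
      mul_le_mul_of_nonneg_right measureReal_le_one (by positivity)
    linarith

/-- The revenue from posting a high price is bounded. -/
lemma mul_one_sub_cdf_le {c d : ℝ} (hc : 0 < cdf D c) (hcd : c ≤ d) :
    d * (1 - cdf D d) ≤ |c| + |virtualValue D f c| := by
  have := hreg.prob
  have h := hreg.integral_virtualValue_Icc hc hcd
  have h1 : ∫ v in Icc c d, (-|virtualValue D f c|) ∂D ≤ ∫ v in Icc c d, virtualValue D f v ∂D := by
    refine setIntegral_mono_on (integrable_const _)
      ((hreg.integrableOn_virtualValue_Ici hc).mono_set Icc_subset_Ici_self)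
      measurableSet_Icc fun v hv => ?_
    linarith [hreg.virtualValue_mono hc hv.1, neg_abs_le (virtualValue D f c)]
  rw [setIntegral_const, smul_eq_mul] at h1
  have h2 : c * D.real (Ici c) ≤ |c| * 1 :=
    mul_le_mul (le_abs_self c) measureReal_le_one measureReal_nonneg (abs_nonneg c)
  have h4 : D.real (Icc c d) * |virtualValue D f c| ≤ 1 * |virtualValue D f c| :=
    mul_le_mul_of_nonneg_right measureReal_le_one (by positivity)
  linarith

end IsRegular

lemma exists_seq_mem_eventually_le {J : Set ℝ} (hJ : J.Nonempty) :
    ∃ c : ℕ → ℝ, (∀ k, c k ∈ J) ∧ ∀ v ∈ J, ∀ᶠ k in atTop, c k ≤ v := by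
  by_cases hbdd : BddBelow J
  · by_cases hmem : sInf J ∈ J
    · exact ⟨fun _ => sInf J, fun _ => hmem, fun v hv =>
        Eventually.of_forall fun _ => csInf_le hbdd hv⟩
    · obtain ⟨c, -, -, hc, hcJ⟩ := (isGLB_csInf hJ hbdd).exists_seq_antitone_tendsto hJ
      refine ⟨c, hcJ, fun v hv => ?_⟩
      have hlt : sInf J < v := (csInf_le hbdd hv).lt_of_ne fun h => hmem (h ▸ hv)
      filter_upwards [hc.eventually (gt_mem_nhds hlt)] with k hk using hk.le
  · have := fun k : ℕ => not_bddBelow_iff.1 hbdd (-(k : ℝ))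
    choose c hcJ hc using this
    refine ⟨c, hcJ, fun v _ => ?_⟩
    filter_upwards [eventually_ge_atTop ⌈-v⌉₊] with k hk
    have := Nat.ceil_le.1 hk
    linarith [hc k]

namespace IsRegular

variable (hreg : IsRegular D f)

include hreg

/-- If no agent in the support has negative utility and the expected payment exists, then so does
the expected virtual value of the allocation. -/
lemma integrable_virtualValue_mul (hx : IsMonotoneAlloc x) (hr : r ∈ D.support) (hr0 : 0 < cdf D r)
    (hφ : virtualValue D f r ≤ 0)
    (hu : ∀ v ∈ D.support, 0 < cdf D v → 0 ≤ envelopeUtility r u₀ x v)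
    (ht : Integrable (envelopePay r u₀ x) D) :
    Integrable (fun v => virtualValue D f v * x v) D := by
  have := hreg.prob
  obtain ⟨c, hcJ, hc⟩ := exists_seq_mem_eventually_le
    (J := {v | v ∈ D.support ∧ 0 < cdf D v}) ⟨r, hr, hr0⟩
  have hIcc : ∀ k d, IntegrableOn (fun v => virtualValue D f v * x v) (Icc (c k) d) D := by
    intro k d
    simpa only [mul_comm] using hreg.integrableOn_mul_virtualValue (d := d) hx.mono.measurable
      hx.abs_le_one (hcJ k).2
  have hleft : IntegrableOn (fun v => virtualValue D f v * x v) (Iic r) D := by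
    have hcover : AECover (D.restrict (Iic r)) atTop fun k => Ici (c k) :=
      ⟨ae_restrict_of_ae (hreg.ae_mem_support_and_cdf_pos.mono fun v hv => hc v hv),
        fun k => measurableSet_Ici⟩
    refine hcover.integrable_of_integral_norm_bounded
      (∫ v, ‖envelopePay r u₀ x v‖ ∂D + |envelopeUtility r u₀ x r|) (fun k => ?_) ?_
    · rw [IntegrableOn, Measure.restrict_restrict measurableSet_Ici, Ici_inter_Iic]
      exact hIcc k r
    · filter_upwards [hc r ⟨hr, hr0⟩] with k hk
      rw [Measure.restrict_restrict measurableSet_Ici, Ici_inter_Iic]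
      have h1 : ∫ v in Icc (c k) r, ‖virtualValue D f v * x v‖ ∂D
          = -∫ v in Icc (c k) r, virtualValue D f v * x v ∂D := by
        rw [← integral_neg]
        refine setIntegral_congr_fun measurableSet_Icc fun v hv => ?_
        have h := (hreg.virtualValue_mono ((hcJ k).2.trans_le (monotone_cdf D hv.1)) hv.2).trans hφ
        exact Real.norm_of_nonpos (mul_nonpos_of_nonpos_of_nonneg h (hx.nonneg v))
      have h2 := hreg.integral_envelopePay (r := r) (u₀ := u₀) hx (hcJ k).2 hk
      have h3 : |∫ v in Icc (c k) r, envelopePay r u₀ x v ∂D| ≤ ∫ v, ‖envelopePay r u₀ x v‖ ∂D :=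
        (norm_integral_le_integral_norm _).trans
          (setIntegral_le_integral ht.norm (Eventually.of_forall fun _ => norm_nonneg _))
      have h4 : 0 ≤ D.real (Ici (c k)) * envelopeUtility r u₀ x (c k) :=
        mul_nonneg measureReal_nonneg (hu _ (hcJ k).1 (hcJ k).2)
      have h5 : (1 - cdf D r) * envelopeUtility r u₀ x r ≤ 1 * |envelopeUtility r u₀ x r| :=
        mul_le_mul (by linarith [cdf_nonneg D r]) (le_abs_self _) (hu r hr hr0) zero_le_one
      rw [h1]
      linarith [neg_abs_le (∫ v in Icc (c k) r, envelopePay r u₀ x v ∂D)]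
  have hright : IntegrableOn (fun v => virtualValue D f v * x v) (Ici r) D :=
    (hreg.integrableOn_virtualValue_Ici hr0).mul_bdd (c := 1)
      hx.mono.measurable.aestronglyMeasurable (Eventually.of_forall hx.abs_le_one)
  have := hleft.union hright
  rwa [Iic_union_Ici, integrableOn_univ] at this

/-- The payment inequality on `(-∞, d]`: utilities at the bottom of the support only reduce
payments. -/
lemma integral_envelopePay_Iic_le (hx : IsMonotoneAlloc x) (hr : r ∈ D.support)
    (hr0 : 0 < cdf D r) (hφ : virtualValue D f r ≤ 0)
    (hu : ∀ v ∈ D.support, 0 < cdf D v → 0 ≤ envelopeUtility r u₀ x v)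
    (ht : Integrable (envelopePay r u₀ x) D) {d : ℝ} (hd : r ≤ d) :
    ∫ v in Iic d, envelopePay r u₀ x v ∂D ≤
      ∫ v in Iic d, virtualValue D f v * x v ∂D + (1 - cdf D d) * envelopeUtility r u₀ x d := by
  have := hreg.prob
  obtain ⟨c, hcJ, hc⟩ := exists_seq_mem_eventually_le
    (J := {v | v ∈ D.support ∧ 0 < cdf D v}) ⟨r, hr, hr0⟩
  have hcover : AECover (D.restrict (Iic d)) atTop fun k => Ici (c k) :=
    ⟨ae_restrict_of_ae (hreg.ae_mem_support_and_cdf_pos.mono fun v hv => hc v hv),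
      fun k => measurableSet_Ici⟩
  have hi := hreg.integrable_virtualValue_mul hx hr hr0 hφ hu ht
  refine le_of_tendsto_of_tendsto
    (hcover.integral_tendsto_of_countably_generated ht.integrableOn)
    ((hcover.integral_tendsto_of_countably_generated hi.integrableOn).add_const _) ?_
  filter_upwards [hc r ⟨hr, hr0⟩] with k hk
  rw [Measure.restrict_restrict measurableSet_Ici, Ici_inter_Iic,
    hreg.integral_envelopePay (r := r) (u₀ := u₀) hx (hcJ k).2 (hk.trans hd)]
  have h4 : 0 ≤ D.real (Ici (c k)) * envelopeUtility r u₀ x (c k) :=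
    mul_nonneg measureReal_nonneg (hu _ (hcJ k).1 (hcJ k).2)
  linarith

/-- An upper bound for the expected payment in which the boundary term is the revenue from the
values above `d`. -/
lemma integral_envelopePay_le (hx : IsMonotoneAlloc x) (hr : r ∈ D.support)
    (hr0 : 0 < cdf D r) (hφ : virtualValue D f r ≤ 0)
    (hu : ∀ v ∈ D.support, 0 < cdf D v → 0 ≤ envelopeUtility r u₀ x v)
    (ht : Integrable (envelopePay r u₀ x) D) {σ : ℝ} (hσ : ∀ v ∈ D.support, x v ≤ σ)
    {d : ℝ} (hd : r ≤ d) (hd0 : 0 ≤ d) :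
    ∫ v, envelopePay r u₀ x v ∂D ≤ ∫ v in Iic d, virtualValue D f v * x v ∂D
      + (1 - cdf D d) * (|u₀| + |r| + d * σ) + ∫ v in Ioi d, envelopePay r u₀ x v ∂D := by
  have h1 := hreg.integral_envelopePay_Iic_le hx hr hr0 hφ hu ht hd
  have h2 := integral_add_compl (μ := D) (measurableSet_Iic (a := d)) ht
  rw [compl_Iic] at h2
  have h3 : (1 - cdf D d) * envelopeUtility r u₀ x d ≤ (1 - cdf D d) * (|u₀| + |r| + d * σ) := by
    rcases (cdf_le_one D d).lt_or_eq with h | h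
    · refine mul_le_mul_of_nonneg_left ?_ (by linarith)
      have hdD := hreg.mem_support_of_cdf_pos (hr0.trans_le (monotone_cdf D hd)) h
      have h5 : ∫ z in r..d, x z ≤ (d - r) * x d := by
        have := hx.mul_le_intervalIntegral d r
        rw [intervalIntegral.integral_symm] at this
        linarith
      have h6 : d * x d ≤ d * σ := mul_le_mul_of_nonneg_left (hσ d hdD) hd0
      have h7 : -r * x d ≤ |r| * 1 :=
        mul_le_mul (neg_le_abs r) (hx.le_one d) (hx.nonneg d) (abs_nonneg r)
      unfold envelopeUtility
      linarith [le_abs_self u₀]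
    · rw [h]
      simp
  linarith

/-- The expected payment when nobody below `r` is allocated and all values above `d` are treated
alike: the latter pay a price that makes up for the boundary term. -/
lemma integral_envelopePay_of_flat (hx : IsMonotoneAlloc x) (hr0 : 0 < cdf D r)
    (hx0 : ∀ v < r, x v = 0) {d τ : ℝ} (hd : r ≤ d) (hτ : ∀ v, d < v → x v = τ) :
    Integrable (envelopePay r 0 x) D ∧
    ∫ v, envelopePay r 0 x v ∂D =
      ∫ v in Iic d, virtualValue D f v * x v ∂D + (1 - cdf D d) * (d * τ) := by
  have := hreg.prob
  set u := envelopeUtility r 0 x with hu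
  have hur : u r = 0 := by simp [hu, envelopeUtility]
  have hleft : ∀ v < r, envelopePay r 0 x v = 0 := by
    intro v hv
    have h1 : ∫ z in r..v, x z = 0 := by
      rw [intervalIntegral.integral_symm, intervalIntegral.integral_of_le hv.le,
        integral_Ioc_eq_integral_Ioo, setIntegral_eq_zero_of_forall_eq_zero fun z hz => hx0 z hz.2,
        neg_zero]
    simp [envelopePay, envelopeUtility, hx0 v hv, h1]
  have hright : ∀ v, d < v → envelopePay r 0 x v = d * τ - u d := by
    intro v hv
    have h1 : ∫ z in d..v, x z = (v - d) * τ := by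
      rw [intervalIntegral.integral_of_le hv.le,
        setIntegral_congr_fun measurableSet_Ioc fun z hz => hτ z hz.1]
      simp [hv.le]
    have h2 := hx.envelopeUtility_sub r 0 d v
    rw [envelopePay, hτ v hv]
    rw [← hu] at h2 ⊢
    linarith
  have hmono := hx.monotone_envelopeUtility r 0
  have hint : Integrable (envelopePay r 0 x) D := by
    refine Integrable.of_bound (hx.measurable_envelopePay r 0).aestronglyMeasurable
      (|r| + |d| + |u d| + |d * τ|) (Eventually.of_forall fun v => ?_)
    rw [Real.norm_eq_abs]
    rcases lt_or_ge v r with h | h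
    · rw [hleft v h]
      simp only [abs_zero]
      positivity
    rcases lt_or_ge d v with h' | h'
    · rw [hright v h']
      have := abs_sub (d * τ) (u d)
      linarith [abs_nonneg r, abs_nonneg d]
    · have h1 : |v * x v| ≤ (|r| + |d|) * 1 := by
        rw [abs_mul]
        refine mul_le_mul (abs_le.2 ⟨?_, ?_⟩) (hx.abs_le_one v) (abs_nonneg _) (by positivity)
        · linarith [neg_abs_le r, abs_nonneg d]
        · linarith [le_abs_self d, abs_nonneg r]
      have h2 : |u v| ≤ |u d| := by
        have h0 : 0 ≤ u v := hur ▸ hmono h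
        rw [abs_of_nonneg h0]
        exact (hmono h').trans (le_abs_self _)
      have := abs_sub (v * x v) (u v)
      rw [envelopePay, ← hu]
      linarith [abs_nonneg (d * τ)]
  refine ⟨hint, ?_⟩
  have hIic : ∀ g : ℝ → ℝ, (∀ v < r, g v = 0) → ∫ v in Iic d, g v ∂D = ∫ v in Icc r d, g v ∂D := by
    intro g hg
    refine setIntegral_eq_of_subset_of_forall_sdiff_eq_zero measurableSet_Iic Icc_subset_Iic_self
      fun v hv => hg v ?_
    by_contra h
    exact hv.2 ⟨not_lt.1 h, hv.1⟩
  have h1 := integral_add_compl (μ := D) (measurableSet_Iic (a := d)) hint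
  rw [compl_Iic, setIntegral_congr_fun measurableSet_Ioi fun v hv => hright v hv,
    setIntegral_const, smul_eq_mul, hIic _ hleft, hreg.integral_envelopePay hx hr0 hd, ← hu, hur,
    ← compl_Iic, probReal_compl_eq_one_sub measurableSet_Iic, ← cdf_eq_real] at h1
  rw [← h1, hIic (fun v => virtualValue D f v * x v) fun v hv => by rw [hx0 v hv, mul_zero]]
  ring

end IsRegular

end Envelope

/-! ### Interim expectations -/

section Interim

variable {D : Measure ℝ} [IsProbabilityMeasure D] {n : ℕ}

/-- Redrawing one coordinate does not change the law of the profile. -/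
lemma measurePreserving_update (i : Fin n) :
    MeasurePreserving (fun p : ℝ × (Fin n → ℝ) => Function.update p.2 i p.1)
      (D.prod (profileLaw D n)) (profileLaw D n) := by
  have hm : Measurable fun p : ℝ × (Fin n → ℝ) => Function.update p.2 i p.1 := by
    refine measurable_pi_lambda _ fun j => ?_
    rcases eq_or_ne j i with rfl | hj
    · simpa using measurable_fst
    · simp only [Function.update_of_ne hj]
      exact (measurable_pi_apply j).comp measurable_snd
  refine ⟨hm, (Measure.pi_eq fun s hs => ?_).symm⟩
  rw [Measure.map_apply hm (MeasurableSet.univ_pi hs)]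
  have hpre : (fun p : ℝ × (Fin n → ℝ) => Function.update p.2 i p.1) ⁻¹' univ.pi s
      = s i ×ˢ univ.pi (Function.update s i univ) := by
    ext ⟨z, v⟩
    simp only [mem_preimage, mem_univ_pi, mem_prod]
    constructor
    · intro h
      refine ⟨by simpa using h i, fun j => ?_⟩
      rcases eq_or_ne j i with rfl | hj
      · simp
      · simpa [Function.update_of_ne hj] using h j
    · rintro ⟨h1, h2⟩ j
      rcases eq_or_ne j i with rfl | hj
      · simpa using h1
      · simpa [Function.update_of_ne hj] using h2 j
  rw [hpre, Measure.prod_prod, Measure.pi_pi,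
    ← Finset.mul_prod_erase Finset.univ (fun j => D (s j)) (Finset.mem_univ i),
    ← Finset.mul_prod_erase Finset.univ (fun j => D (Function.update s i univ j))
      (Finset.mem_univ i)]
  simp only [Function.update_self, measure_univ, one_mul]
  congr 1
  refine Finset.prod_congr rfl fun j hj => ?_
  rw [Function.update_of_ne (Finset.ne_of_mem_erase hj)]

lemma integrable_update_prod (i : Fin n) {g : (Fin n → ℝ) → ℝ}
    (hg : Integrable g (profileLaw D n)) :
    Integrable (fun p : ℝ × (Fin n → ℝ) => g (Function.update p.2 i p.1))
      (D.prod (profileLaw D n)) :=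
  ((measurePreserving_update i).integrable_comp hg.aestronglyMeasurable).2 hg

lemma integral_update_prod (i : Fin n) {g : (Fin n → ℝ) → ℝ}
    (hg : AEStronglyMeasurable g (profileLaw D n)) :
    ∫ p : ℝ × (Fin n → ℝ), g (Function.update p.2 i p.1) ∂(D.prod (profileLaw D n))
      = ∫ v, g v ∂(profileLaw D n) := by
  have h := measurePreserving_update (D := D) i
  conv_rhs => rw [← h.map_eq]
  rw [integral_map h.measurable.aemeasurable (by rwa [h.map_eq])]

lemma integrable_interim (i : Fin n) {g : (Fin n → ℝ) → ℝ} (hg : Integrable g (profileLaw D n)) :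
    Integrable (fun z => ∫ v, g (Function.update v i z) ∂(profileLaw D n)) D :=
  (integrable_update_prod i hg).integral_prod_left

lemma integral_interim (i : Fin n) {g : (Fin n → ℝ) → ℝ} (hg : Integrable g (profileLaw D n)) :
    ∫ z, (∫ v, g (Function.update v i z) ∂(profileLaw D n)) ∂D = ∫ v, g v ∂(profileLaw D n) := by
  rw [← integral_update_prod i hg.aestronglyMeasurable]
  exact integral_integral (f := fun z v => g (Function.update v i z)) (integrable_update_prod i hg)

lemma integrable_mul_of_interim (i : Fin n) {g : (Fin n → ℝ) → ℝ}
    (hg : Integrable g (profileLaw D n)) (hg0 : ∀ v, 0 ≤ g v) {h : ℝ → ℝ} (hh : Measurable h)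
    (hi : Integrable (fun z => h z * ∫ v, g (Function.update v i z) ∂(profileLaw D n)) D) :
    Integrable (fun v => h (v i) * g v) (profileLaw D n) := by
  have hmeas : AEStronglyMeasurable (fun v : Fin n → ℝ => h (v i) * g v) (profileLaw D n) :=
    (hh.comp (measurable_pi_apply i)).aestronglyMeasurable.mul hg.aestronglyMeasurable
  have hp := measurePreserving_update (D := D) i
  rw [← hp.integrable_comp hmeas, integrable_prod_iff (hmeas.comp_measurePreserving hp)]
  have hgi := integrable_update_prod i hg
  refine ⟨?_, ?_⟩
  · filter_upwards [hgi.prod_right_ae] with z hz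
    simpa using hz.const_mul (h z)
  · refine hi.norm.congr (Eventually.of_forall fun z => ?_)
    simp only [Function.comp_apply, Function.update_self, norm_mul]
    rw [integral_const_mul, Real.norm_of_nonneg (integral_nonneg fun v => hg0 _)]
    congr 1
    exact integral_congr_ae (Eventually.of_forall fun v => (Real.norm_of_nonneg (hg0 _)).symm)

lemma integral_mul_eq_interim (i : Fin n) {g : (Fin n → ℝ) → ℝ} {h : ℝ → ℝ}
    (hi : Integrable (fun v => h (v i) * g v) (profileLaw D n)) :
    ∫ v, h (v i) * g v ∂(profileLaw D n)
      = ∫ z, h z * ∫ v, g (Function.update v i z) ∂(profileLaw D n) ∂D := by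
  rw [← integral_interim i hi]
  simp only [Function.update_self, integral_const_mul]

end Interim

/-! ### Equilibria as monotone allocations with envelope payments -/

section Equilibrium

/-- A function whose increments are bounded by those of a monotone function, times the length of
the interval, is constant. -/
lemma eq_of_abs_sub_le_mul {h g : ℝ → ℝ} {a b : ℝ} (hab : a ≤ b)
    (H : ∀ v w, a ≤ v → v ≤ w → w ≤ b → |h w - h v| ≤ (w - v) * (g w - g v)) : h a = h b := by
  have key : ∀ N : ℕ, |h b - h a| ≤ (b - a) * (g b - g a) / (N + 1) := by
    intro N
    set p : ℕ → ℝ := fun k => a + k * ((b - a) / (N + 1)) with hp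
    have hN : (0 : ℝ) < N + 1 := by positivity
    have hp0 : p 0 = a := by simp [hp]
    have hpN : p (N + 1) = b := by
      simp only [hp]
      push_cast
      field_simp
      ring
    have hstep : ∀ k, p (k + 1) - p k = (b - a) / (N + 1) := by
      intro k
      simp only [hp]
      push_cast
      ring
    have hmono : Monotone p := monotone_nat_of_le_succ fun k => by
      have := hstep k
      have h2 : 0 ≤ (b - a) / (N + 1) := div_nonneg (sub_nonneg.2 hab) hN.le
      linarith
    calc |h b - h a| = |∑ k ∈ Finset.range (N + 1), (h (p (k + 1)) - h (p k))| := by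
          rw [Finset.sum_range_sub (fun k => h (p k)), hp0, hpN]
      _ ≤ ∑ k ∈ Finset.range (N + 1), |h (p (k + 1)) - h (p k)| := Finset.abs_sum_le_sum_abs _ _
      _ ≤ ∑ k ∈ Finset.range (N + 1), (b - a) / (N + 1) * (g (p (k + 1)) - g (p k)) := by
          refine Finset.sum_le_sum fun k hk => ?_
          rw [← hstep k]
          refine H _ _ (hp0 ▸ hmono (Nat.zero_le k)) (hmono (Nat.le_succ k)) ?_
          exact hpN ▸ hmono (Finset.mem_range.1 hk)
      _ = (b - a) * (g b - g a) / (N + 1) := by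
          rw [← Finset.mul_sum, Finset.sum_range_sub (fun k => g (p k)), hp0, hpN]
          ring
  have hlim : Tendsto (fun N : ℕ => (b - a) * (g b - g a) / ((N : ℝ) + 1)) atTop (𝓝 0) :=
    ((tendsto_const_div_atTop_nhds_zero_nat ((b - a) * (g b - g a))).comp
      (tendsto_add_atTop_nat 1)).congr fun N => by simp
  have h0 := ge_of_tendsto' hlim key
  have := abs_nonpos_iff.1 h0
  linarith

variable {Advice : Type*} {Bid : Type*} {n : ℕ} {B : BlockBuildingProcess Advice Bid}
  {D : Measure ℝ} {f : ℝ → ℝ} {M : OffChainMechanism Advice Bid n} {s : ∀ i, ℝ → M.Msg i}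

lemma messages_update (v : Fin n → ℝ) (i : Fin n) (z : ℝ) :
    M.messages s (Function.update v i z) = M.messagesWith s i (s i z) v := by
  unfold OffChainMechanism.messages OffChainMechanism.messagesWith
  ext j
  rcases eq_or_ne j i with rfl | hj
  · simp
  · simp [Function.update_of_ne hj, OffChainMechanism.messages]

variable (M B D s) in
/-- The allocation probability of user `i` who behaves as if his value were `z`. -/
def interimAlloc (i : Fin n) (z : ℝ) : ℝ :=
  ∫ v, (M.play (M.messages s (Function.update v i z))).userAlloc B i ∂(profileLaw D n)

variable (M B D s) in
/-- The expected payment of user `i` who behaves as if his value were `z`. -/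
def interimPay (i : Fin n) (z : ℝ) : ℝ :=
  ∫ v, M.totalPay B (M.messages s (Function.update v i z)) i ∂(profileLaw D n)

/-- Between two points of the support above the bottom of the support there is only support. -/
lemma IsRegular.mem_support_of_mem_Icc (hreg : IsRegular D f) {v w z : ℝ} (hv0 : 0 < cdf D v)
    (hw : w ∈ D.support) (hz : z ∈ Icc v w) : z ∈ D.support := by
  have := hreg.prob
  rcases hz.2.eq_or_lt with rfl | hzw
  · exact hw
  refine hreg.mem_support_of_cdf_pos (hv0.trans_le (monotone_cdf D hz.1)) ?_
  refine (cdf_le_one D z).lt_of_ne fun h1 => ?_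
  have h2 := (Measure.mem_support_iff_forall w).1 hw (Ioi z) (Ioi_mem_nhds hzw)
  have h3 : D.real (Ioi z) = 0 := by
    rw [← compl_Iic, probReal_compl_eq_one_sub measurableSet_Iic, ← cdf_eq_real, h1, sub_self]
  rw [measureReal_eq_zero_iff] at h3
  exact h2.ne' h3

variable (hs : M.IsBNE B D s)

include hs

lemma interimUtility_eq (i : Fin n) (v z : ℝ) :
    M.interimUtility B D s i v (s i z) = v * interimAlloc B D M s i z - interimPay B D M s i z := by
  unfold OffChainMechanism.interimUtility interimAlloc interimPay
  simp only [messages_update]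
  rw [integral_sub ((hs.alloc_integrable_dev i _).const_mul v) (hs.pay_integrable_dev i _),
    integral_const_mul]

/-- In equilibrium, the interim allocation is monotone on the support, and interim payments and
utilities are given by the envelope theorem. -/
lemma exists_isMonotoneAlloc (hreg : IsRegular D f) {r : ℝ} (hr : r ∈ D.support)
    (hr0 : 0 < cdf D r) (i : Fin n) :
    ∃ (x : ℝ → ℝ) (u₀ : ℝ), IsMonotoneAlloc x ∧
      (∀ v ∈ D.support, x v = interimAlloc B D M s i v) ∧
      (∀ v ∈ D.support, 0 < cdf D v → envelopePay r u₀ x v = interimPay B D M s i v) ∧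
      (∀ v ∈ D.support, 0 < cdf D v → 0 ≤ envelopeUtility r u₀ x v) := by
  have := hreg.prob
  set X := interimAlloc B D M s i with hX
  set T := interimPay B D M s i with hT
  have hX0 : ∀ v, 0 ≤ X v := fun v => integral_nonneg fun _ => OnChainPlay.userAlloc_nonneg B _ _
  have hX1 : ∀ v, X v ≤ 1 := by
    intro v
    have hint : Integrable (fun w => (M.play (M.messages s (Function.update w i v))).userAlloc B i)
        (profileLaw D n) := by
      simpa only [messages_update] using hs.alloc_integrable_dev i (s i v)
    have := integral_mono hint (integrable_const 1) fun w => OnChainPlay.userAlloc_le_one B _ _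
    simpa [hX, interimAlloc] using this
  have hIC : ∀ v ∈ D.support, ∀ w, v * X w - T w ≤ v * X v - T v := by
    intro v hv w
    have := hs.best_response i v hv (s i w)
    rwa [interimUtility_eq hs, interimUtility_eq hs] at this
  have hIR : ∀ v ∈ D.support, 0 ≤ v * X v - T v := by
    intro v hv
    have := hs.participation i v hv
    rwa [interimUtility_eq hs] at this
  have hmono : MonotoneOn X D.support := by
    intro v hv w hw hvw
    rcases hvw.eq_or_lt with rfl | hlt
    · exact le_rfl
    have h1 := hIC v hv w
    have h2 := hIC w hw v
    have h3 : 0 ≤ (w - v) * (X w - X v) := by linarith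
    have := nonneg_of_mul_nonneg_right h3 (sub_pos.2 hlt)
    linarith
  obtain ⟨y, hy, hyX⟩ := hmono.exists_monotone_extension
    ⟨0, by rintro _ ⟨v, -, rfl⟩; exact hX0 v⟩ ⟨1, by rintro _ ⟨v, -, rfl⟩; exact hX1 v⟩
  set x : ℝ → ℝ := fun v => max 0 (min 1 (y v)) with hx
  have hxa : IsMonotoneAlloc x :=
    ⟨fun v w h => max_le_max le_rfl (min_le_min le_rfl (hy h)), fun v => le_max_left _ _,
      fun v => max_le zero_le_one (min_le_left _ _)⟩
  have hxX : ∀ v ∈ D.support, x v = X v := by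
    intro v hv
    simp only [hx, ← hyX hv, min_eq_right (hX1 v), max_eq_right (hX0 v)]
  set u₀ := r * X r - T r with hu₀
  -- the equilibrium utility minus the envelope utility is constant
  have hconst : ∀ v w, v ∈ D.support → w ∈ D.support → 0 < cdf D v → v ≤ w →
      (v * X v - T v) - envelopeUtility r u₀ x v = (w * X w - T w) - envelopeUtility r u₀ x w := by
    intro v w hv hw hv0 hvw
    refine eq_of_abs_sub_le_mul (h := fun v => (v * X v - T v) - envelopeUtility r u₀ x v) (g := x)
      hvw fun a b ha hab hb => ?_
    have has : a ∈ D.support := hreg.mem_support_of_mem_Icc hv0 hw ⟨ha, hab.trans hb⟩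
    have hbs : b ∈ D.support := hreg.mem_support_of_mem_Icc hv0 hw ⟨ha.trans hab, hb⟩
    have h1 := hIC a has b
    have h2 := hIC b hbs a
    have h3 := hxa.envelopeUtility_sub r u₀ a b
    have h4 := hxa.mul_le_intervalIntegral a b
    have h5 := hxa.mul_le_intervalIntegral b a
    rw [intervalIntegral.integral_symm] at h5
    rw [hxX a has] at h4 ⊢
    rw [hxX b hbs] at h5 ⊢
    rw [abs_le]
    constructor <;> linarith
  have hutil : ∀ v ∈ D.support, 0 < cdf D v → envelopeUtility r u₀ x v = v * X v - T v := by
    intro v hv hv0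
    have hr1 : envelopeUtility r u₀ x r = u₀ := by simp [envelopeUtility]
    rcases le_total v r with h | h
    · have := hconst v r hv hr hv0 h
      rw [hr1] at this
      linarith
    · have := hconst r v hr hv hr0 h
      rw [hr1] at this
      linarith
  refine ⟨x, u₀, hxa, hxX, fun v hv hv0 => ?_, fun v hv hv0 => ?_⟩
  · rw [envelopePay, hutil v hv hv0, hxX v hv]
    ring
  · rw [hutil v hv hv0]
    exact hIR v hv

end Equilibrium

/-! ### Direct mechanisms -/

section Direct

variable {Advice : Type*} {Bid : Type*} {n : ℕ} {B : BlockBuildingProcess Advice Bid}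
  {D : Measure ℝ} {f : ℝ → ℝ}

/-- If a revenue-optimal equilibrium exists, then burns are bounded below: the miner could censor
everybody and realize any possible burn with certainty. -/
lemma isBurnBounded_of_isRevenueOptimal [IsProbabilityMeasure D]
    {M : OffChainMechanism Advice Bid n} {s : ∀ i, ℝ → M.Msg i} (h : M.IsRevenueOptimal B D s) :
    IsBurnBounded B n := by
  refine ⟨⟨M.play (M.messages s 0)⟩, -M.expectedRevenue B D s, ?_⟩
  rintro _ ⟨p, rfl⟩
  set M' : OffChainMechanism Advice Bid n :=
    { Msg := fun _ => Unit
      play := fun _ => p.censor ∅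
      transfer := fun _ _ => 0 } with hM'
  set s' : ∀ i, ℝ → M'.Msg i := fun _ _ => () with hs'
  have halloc : ∀ u i, (M'.play u).userAlloc B i = 0 := fun u i =>
    OnChainPlay.userAlloc_censor_of_notMem B p (notMem_empty i)
  have hpay : ∀ u i, M'.totalPay B u i = 0 := by
    intro u i
    show ((p.censor ∅).slot i).elim 0 _ + (0 : ℝ) = 0
    simp [OnChainPlay.censor, Option.elim]
  have hburn : ∀ u, (M'.play u).burnt B = p.burnt B := fun u => rfl
  have hutil : ∀ i x m, M'.interimUtility B D s' i x m = 0 := by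
    intro i x m
    simp [OffChainMechanism.interimUtility, halloc, hpay]
  have hBNE : M'.IsBNE B D s' := by
    constructor <;> simp [halloc, hpay, hutil, hburn]
  have hrev := h.2 M' s' hBNE
  have : M'.expectedRevenue B D s' = -p.burnt B := by
    simp [OffChainMechanism.expectedRevenue, hpay, hburn]
  rw [this] at hrev
  show -M.expectedRevenue B D s ≤ p.burnt B
  linarith

/-- The interim allocation of user `i` when everybody reports truthfully and the miner plays by the
rule `P`. -/
def ruleAlloc (B : BlockBuildingProcess Advice Bid) (D : Measure ℝ)
    (P : (Fin n → ℝ) → OnChainPlay Advice Bid n) (i : Fin n) (z : ℝ) : ℝ :=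
  ∫ v, (P (Function.update v i z)).userAlloc B i ∂(profileLaw D n)

/-- The direct mechanism that asks for the values, plays by the rule `P` and uses transfers to
charge every user the envelope payment for his interim allocation. -/
abbrev directMechanism (B : BlockBuildingProcess Advice Bid) (D : Measure ℝ) (r : ℝ)
    (P : (Fin n → ℝ) → OnChainPlay Advice Bid n) : OffChainMechanism Advice Bid n where
  Msg := fun _ => ℝ
  play := P
  transfer := fun m i => envelopePay r 0 (ruleAlloc B D P i) (m i) - (P m).userPay B i

/-- The hypotheses under which `directMechanism` is truthful. -/
structure IsTruthfulRule (B : BlockBuildingProcess Advice Bid) (D : Measure ℝ) (r : ℝ)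
    (P : (Fin n → ℝ) → OnChainPlay Advice Bid n) : Prop where
  measurable_alloc : ∀ i, Measurable fun v => (P v).userAlloc B i
  integrable_burnt : Integrable (fun v => (P v).burnt B) (profileLaw D n)
  monotone : ∀ i, IsMonotoneAlloc (ruleAlloc B D P i)
  eq_zero : ∀ i, ∀ v < r, ruleAlloc B D P i v = 0
  integrable_pay : ∀ i, Integrable (envelopePay r 0 (ruleAlloc B D P i)) D

namespace IsTruthfulRule

variable {r : ℝ} {P : (Fin n → ℝ) → OnChainPlay Advice Bid n}

lemma totalPay_directMechanism (m : Fin n → ℝ) (i : Fin n) :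
    (directMechanism B D r P).totalPay B m i = envelopePay r 0 (ruleAlloc B D P i) (m i) := by
  show (P m).userPay B i + (envelopePay r 0 (ruleAlloc B D P i) (m i) - (P m).userPay B i) = _
  ring

variable [IsProbabilityMeasure D] (hP : IsTruthfulRule B D r P)

include hP

lemma integrable_alloc (i : Fin n) :
    Integrable (fun v => (P v).userAlloc B i) (profileLaw D n) :=
  Integrable.of_bound (hP.measurable_alloc i).aestronglyMeasurable 1
    (Eventually.of_forall fun v => abs_le.2
      ⟨by linarith [(P v).userAlloc_nonneg B i], (P v).userAlloc_le_one B i⟩)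

lemma integrable_alloc_update (i : Fin n) (z : ℝ) :
    Integrable (fun v => (P (Function.update v i z)).userAlloc B i) (profileLaw D n) :=
  Integrable.of_bound ((hP.measurable_alloc i).comp measurable_update_left).aestronglyMeasurable 1
    (Eventually.of_forall fun v => abs_le.2
      ⟨by linarith [(P (Function.update v i z)).userAlloc_nonneg B i],
        (P _).userAlloc_le_one B i⟩)

lemma integrable_pay_eval (i : Fin n) :
    Integrable (fun v : Fin n → ℝ => envelopePay r 0 (ruleAlloc B D P i) (v i)) (profileLaw D n) :=
  (measurePreserving_eval (fun _ : Fin n => D) i).integrable_comp_of_integrable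
    (hP.integrable_pay i)

lemma isBNE : (directMechanism B D r P).IsBNE B D (fun _ z => z) := by
  have hutil : ∀ i (v z : ℝ), (directMechanism B D r P).interimUtility B D (fun _ z => z) i v z
      = (v - z) * ruleAlloc B D P i z + envelopeUtility r 0 (ruleAlloc B D P i) z := by
    intro i v z
    have h : ∀ w : Fin n → ℝ, (directMechanism B D r P).messagesWith (fun _ z => z) i z w
        = Function.update w i z := fun w => rfl
    have h2 : (directMechanism B D r P).interimUtility B D (fun _ z => z) i v z
        = ∫ w, (v * (P (Function.update w i z)).userAlloc B i
          - envelopePay r 0 (ruleAlloc B D P i) z) ∂(profileLaw D n) := by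
      refine integral_congr_ae (Eventually.of_forall fun w => ?_)
      beta_reduce
      rw [h, totalPay_directMechanism, Function.update_self]
    rw [h2, integral_sub ((hP.integrable_alloc_update i z).const_mul v) (integrable_const _),
      integral_const_mul, integral_const]
    simp only [probReal_univ, one_smul, envelopePay]
    change v * ruleAlloc B D P i z - _ = _
    ring
  refine ⟨hP.integrable_alloc, fun i => ?_, hP.integrable_burnt,
    fun i z => hP.integrable_alloc_update i z, fun i z => ?_, fun i v _ z => ?_, fun i v _ => ?_⟩
  · refine (hP.integrable_pay_eval i).congr (Eventually.of_forall fun v => ?_)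
    exact (totalPay_directMechanism _ i).symm
  · refine (integrable_const (envelopePay r 0 (ruleAlloc B D P i) z)).congr
      (Eventually.of_forall fun v => ?_)
    refine Eq.trans ?_ (totalPay_directMechanism _ i).symm
    rw [OffChainMechanism.messagesWith, Function.update_self]
  · rw [hutil i v v]
    refine (hutil i v z).trans_le ?_
    have h1 := (hP.monotone i).mul_le_intervalIntegral z v
    have h2 := (hP.monotone i).envelopeUtility_sub r 0 z v
    linarith
  · rw [hutil, sub_self, zero_mul, zero_add, envelopeUtility, zero_add]
    rcases le_total r v with h | h
    · exact intervalIntegral.integral_nonneg h fun z _ => (hP.monotone i).nonneg z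
    · rw [intervalIntegral.integral_symm, intervalIntegral.integral_of_le h,
        integral_Ioc_eq_integral_Ioo,
        setIntegral_eq_zero_of_forall_eq_zero fun z hz => hP.eq_zero i z hz.2, neg_zero]

lemma expectedRevenue_eq : (directMechanism B D r P).expectedRevenue B D (fun _ z => z)
    = ∑ i, ∫ z, envelopePay r 0 (ruleAlloc B D P i) z ∂D
      - ∫ v, (P v).burnt B ∂(profileLaw D n) := by
  have h : (directMechanism B D r P).expectedRevenue B D (fun _ z => z)
      = ∫ v, (∑ i, envelopePay r 0 (ruleAlloc B D P i) (v i) - (P v).burnt B)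
        ∂(profileLaw D n) := by
    refine integral_congr_ae (Eventually.of_forall fun v => ?_)
    exact congrArg (· - (P v).burnt B)
      (Finset.sum_congr rfl fun i _ => totalPay_directMechanism _ i)
  rw [h, integral_sub (integrable_finsetSum _ fun i _ => hP.integrable_pay_eval i)
    hP.integrable_burnt, integral_finsetSum _ fun i _ => hP.integrable_pay_eval i]
  congr 1
  refine Finset.sum_congr rfl fun i _ => ?_
  exact integral_comp_eval (μ := fun _ : Fin n => D) (hP.integrable_pay i).aestronglyMeasurable

end IsTruthfulRule

end Direct

/-! ### Maximizing the virtual surplus over finitely many plays -/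

section BestPlay

variable {Advice : Type*} {Bid : Type*} {n : ℕ} (B : BlockBuildingProcess Advice Bid)
  (q : ℕ → OnChainPlay Advice Bid n)

/-- The first index `k ≤ N` at which `q k` has the largest virtual surplus among `q 0, …, q N`. -/
def bestPlay : ℕ → (Fin n → ℝ) → ℕ
  | 0, _ => 0
  | N + 1, y => if (q (bestPlay N y)).surplus B y < (q (N + 1)).surplus B y then N + 1
      else bestPlay N y

lemma bestPlay_le (N : ℕ) (y : Fin n → ℝ) : bestPlay B q N y ≤ N := by
  induction N with
  | zero => exact le_rfl
  | succ N ih =>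
    rw [bestPlay]
    split_ifs
    · exact le_rfl
    · exact ih.trans N.le_succ

lemma surplus_le_bestPlay {N k : ℕ} (hk : k ≤ N) (y : Fin n → ℝ) :
    (q k).surplus B y ≤ (q (bestPlay B q N y)).surplus B y := by
  induction N with
  | zero => rw [Nat.le_zero.1 hk, bestPlay]
  | succ N ih =>
    rw [bestPlay]
    rcases hk.eq_or_lt with rfl | hk
    · split_ifs with h
      · exact le_rfl
      · exact not_lt.1 h
    · split_ifs with h
      · exact (ih (Nat.lt_succ_iff.1 hk)).trans h.le
      · exact ih (Nat.lt_succ_iff.1 hk)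

lemma measurable_bestPlay_and_surplus (N : ℕ) : Measurable (bestPlay B q N) ∧
    Measurable fun y => (q (bestPlay B q N y)).surplus B y := by
  induction N with
  | zero => exact ⟨measurable_const, ((q 0).continuous_surplus B).measurable⟩
  | succ N ih =>
    have hset := measurableSet_lt ih.2 ((q (N + 1)).continuous_surplus B).measurable
    refine ⟨Measurable.ite hset measurable_const ih.1, ?_⟩
    have : (fun y => (q (bestPlay B q (N + 1) y)).surplus B y) = fun y =>
        if (q (bestPlay B q N y)).surplus B y < (q (N + 1)).surplus B y
          then (q (N + 1)).surplus B y else (q (bestPlay B q N y)).surplus B y := by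
      ext y
      rw [bestPlay]
      split_ifs <;> rfl
    rw [this]
    exact Measurable.ite hset ((q (N + 1)).continuous_surplus B).measurable ih.2

lemma measurable_bestPlay (N : ℕ) : Measurable (bestPlay B q N) :=
  (measurable_bestPlay_and_surplus B q N).1

lemma measurable_surplus_bestPlay (N : ℕ) :
    Measurable fun y => (q (bestPlay B q N y)).surplus B y :=
  (measurable_bestPlay_and_surplus B q N).2

/-- The allocation that maximizes the virtual surplus is monotone: the surplus is affine in each
virtual value, with slope the allocation. -/
lemma userAlloc_bestPlay_mono (N : ℕ) {y z : Fin n → ℝ} {i : Fin n} (hi : y i ≤ z i)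
    (hne : ∀ j, j ≠ i → y j = z j) :
    (q (bestPlay B q N y)).userAlloc B i ≤ (q (bestPlay B q N z)).userAlloc B i := by
  rcases hi.eq_or_lt with h | h
  · have : y = z := by
      ext j
      rcases eq_or_ne j i with rfl | hj
      · exact h
      · exact hne j hj
    rw [this]
  have hsub : ∀ p : OnChainPlay Advice Bid n,
      p.surplus B z - p.surplus B y = p.userAlloc B i * (z i - y i) := by
    intro p
    rw [p.surplus_sub B y z]
    exact Finset.sum_eq_single_of_mem i (Finset.mem_univ i) fun j _ hj => by
      rw [hne j hj, sub_self, mul_zero]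
  have h1 := surplus_le_bestPlay B q (bestPlay_le B q N z) y
  have h2 := surplus_le_bestPlay B q (bestPlay_le B q N y) z
  have h3 := hsub (q (bestPlay B q N y))
  have h4 := hsub (q (bestPlay B q N z))
  have : (q (bestPlay B q N y)).userAlloc B i * (z i - y i)
      ≤ (q (bestPlay B q N z)).userAlloc B i * (z i - y i) := by linarith
  exact le_of_mul_le_mul_right this (sub_pos.2 h)

/-- Play the best among `q 0, …, q N` for the weights `ψ (v i)`, and censor the users with
non-positive weights. -/
def surplusRule (N : ℕ) (ψ : ℝ → ℝ) (v : Fin n → ℝ) : OnChainPlay Advice Bid n :=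
  (q (bestPlay B q N fun j => ψ (v j))).censor {j | 0 < ψ (v j)}

lemma userAlloc_surplusRule (N : ℕ) (ψ : ℝ → ℝ) (v : Fin n → ℝ) (i : Fin n) :
    (surplusRule B q N ψ v).userAlloc B i =
      if 0 < ψ (v i) then (q (bestPlay B q N fun j => ψ (v j))).userAlloc B i else 0 := by
  split_ifs with h
  · exact OnChainPlay.userAlloc_censor_of_mem B _ h
  · exact OnChainPlay.userAlloc_censor_of_notMem B _ h

lemma measurable_userAlloc_surplusRule (N : ℕ) {ψ : ℝ → ℝ} (hψ : Measurable ψ) (i : Fin n) :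
    Measurable fun v => (surplusRule B q N ψ v).userAlloc B i := by
  simp only [userAlloc_surplusRule]
  have h1 : Measurable fun v : Fin n → ℝ => fun j => ψ (v j) :=
    measurable_pi_lambda _ fun j => hψ.comp (measurable_pi_apply j)
  refine Measurable.ite (measurableSet_lt measurable_const (hψ.comp (measurable_pi_apply i))) ?_
    measurable_const
  exact (measurable_from_nat (f := fun k => (q k).userAlloc B i)).comp
    ((measurable_bestPlay B q N).comp h1)

lemma measurable_burnt_surplusRule (N : ℕ) {ψ : ℝ → ℝ} (hψ : Measurable ψ) :
    Measurable fun v : Fin n → ℝ => (surplusRule B q N ψ v).burnt B := by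
  have h1 : Measurable fun v : Fin n → ℝ => fun j => ψ (v j) :=
    measurable_pi_lambda _ fun j => hψ.comp (measurable_pi_apply j)
  exact (measurable_from_nat (f := fun k => (q k).burnt B)).comp
    ((measurable_bestPlay B q N).comp h1)

lemma abs_burnt_surplusRule_le (N : ℕ) (ψ : ℝ → ℝ) (v : Fin n → ℝ) :
    |(surplusRule B q N ψ v).burnt B| ≤ ∑ k ∈ Finset.range (N + 1), |(q k).burnt B| :=
  Finset.single_le_sum (f := fun k => |(q k).burnt B|) (fun _ _ => abs_nonneg _)
    (Finset.mem_range.2 (Nat.lt_succ_of_le (bestPlay_le B q N fun j => ψ (v j))))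

lemma userAlloc_surplusRule_mono (N : ℕ) {ψ : ℝ → ℝ} (hψ : Monotone ψ) (v : Fin n → ℝ) (i : Fin n) :
    Monotone fun z => (surplusRule B q N ψ (Function.update v i z)).userAlloc B i := by
  intro a b hab
  simp only [userAlloc_surplusRule, Function.update_self]
  split_ifs with h1 h2 h2
  · refine userAlloc_bestPlay_mono B q N (i := i) ?_ fun j hj => ?_
    · simpa using hψ hab
    · simp [Function.update_of_ne hj]
  · exact absurd (h1.trans_le (hψ hab)) h2
  · exact OnChainPlay.userAlloc_nonneg B _ i
  · exact le_rfl

variable {B} {D : Measure ℝ} {f : ℝ → ℝ}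

lemma isMonotoneAlloc_ruleAlloc [IsProbabilityMeasure D] (N : ℕ) {ψ : ℝ → ℝ} (hψ : Monotone ψ)
    (i : Fin n) : IsMonotoneAlloc (ruleAlloc B D (surplusRule B q N ψ) i) := by
  have hint : ∀ z, Integrable
      (fun v => (surplusRule B q N ψ (Function.update v i z)).userAlloc B i) (profileLaw D n) :=
    fun z => Integrable.of_bound ((measurable_userAlloc_surplusRule B q N hψ.measurable i).comp
      measurable_update_left).aestronglyMeasurable 1
      (Eventually.of_forall fun v => abs_le.2
        ⟨by linarith [(surplusRule B q N ψ (Function.update v i z)).userAlloc_nonneg B i],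
          OnChainPlay.userAlloc_le_one B _ i⟩)
  refine ⟨fun a b hab => ?_, fun z => ?_, fun z => ?_⟩
  · exact integral_mono (hint a) (hint b) fun v => userAlloc_surplusRule_mono B q N hψ v i hab
  · exact integral_nonneg fun v => OnChainPlay.userAlloc_nonneg B _ i
  · have := integral_mono (hint z) (integrable_const 1) fun v => OnChainPlay.userAlloc_le_one B _ i
    simpa [ruleAlloc] using this

lemma ruleAlloc_eq_zero (N : ℕ) {ψ : ℝ → ℝ} (i : Fin n) {z : ℝ} (hz : ψ z ≤ 0) :
    ruleAlloc B D (surplusRule B q N ψ) i z = 0 := by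
  unfold ruleAlloc
  simp [userAlloc_surplusRule, not_lt.2 hz]

lemma ruleAlloc_congr (N : ℕ) {ψ : ℝ → ℝ} (i : Fin n) {y z : ℝ} (h : ψ y = ψ z) :
    ruleAlloc B D (surplusRule B q N ψ) i y = ruleAlloc B D (surplusRule B q N ψ) i z := by
  have : ∀ v : Fin n → ℝ, (fun j => ψ (Function.update v i y j))
      = fun j => ψ (Function.update v i z j) := by
    intro v
    ext j
    rcases eq_or_ne j i with rfl | hj
    · simp [h]
    · simp [Function.update_of_ne hj]
  unfold ruleAlloc
  simp only [userAlloc_surplusRule, this, Function.update_self, h]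

end BestPlay

/-! ### A nearly optimal truthful mechanism -/

section NearlyOptimal

variable {Advice : Type*} {Bid : Type*} {n : ℕ} {B : BlockBuildingProcess Advice Bid}
  {D : Measure ℝ} {f : ℝ → ℝ} {r d H : ℝ}

/-- The positive part of the virtual value, set to zero below the reserve `r`, frozen above `d`,
and raised by `H` above `d`.  The raise gives values above `d` absolute priority; it recovers the
boundary term of the payment identity at `d`. -/
def cappedVirtualValue (D : Measure ℝ) (f : ℝ → ℝ) (r d H v : ℝ) : ℝ :=
  (if v < r then 0 else max (virtualValue D f (min v d)) 0) + if d < v then H else 0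

lemma cappedVirtualValue_of_lt (hrd : r ≤ d) {v : ℝ} (hv : v < r) :
    cappedVirtualValue D f r d H v = 0 := by
  simp [cappedVirtualValue, hv, (hv.trans_le hrd).le]

lemma cappedVirtualValue_of_gt (hrd : r ≤ d) {v : ℝ} (hv : d < v) :
    cappedVirtualValue D f r d H v = max (virtualValue D f d) 0 + H := by
  simp [cappedVirtualValue, hv, hv.le, hrd.trans hv.le]

namespace IsRegular

variable (hreg : IsRegular D f)

include hreg

lemma cappedVirtualValue_of_le (hφ : virtualValue D f r ≤ 0) {v : ℝ} (hv0 : 0 < cdf D v)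
    (hv : v ≤ d) : cappedVirtualValue D f r d H v = max (virtualValue D f v) 0 := by
  rw [cappedVirtualValue, if_neg (not_lt.2 hv), min_eq_left hv, add_zero]
  split_ifs with h
  · exact (max_eq_right ((hreg.virtualValue_mono hv0 h.le).trans hφ)).symm
  · rfl

lemma monotone_cappedVirtualValue (hr0 : 0 < cdf D r) (hrd : r ≤ d) (hH : 0 ≤ H) :
    Monotone (cappedVirtualValue D f r d H) := by
  intro v w hvw
  refine add_le_add ?_ ?_
  · split_ifs with h1 h2 h2
    · exact le_rfl
    · exact le_max_right _ _
    · exact absurd (hvw.trans_lt h2) h1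
    · refine max_le_max (hreg.virtualValue_mono ?_ (min_le_min hvw le_rfl)) le_rfl
      exact hr0.trans_le (monotone_cdf D (le_min (not_lt.1 h1) hrd))
  · split_ifs with h1 h2 h2
    · exact le_rfl
    · exact absurd (h1.trans_le hvw) h2
    · exact hH
    · exact le_rfl

end IsRegular

/-- The largest virtual surplus among `q 0, …, q N`, with negative virtual values replaced by
zero. -/
def bestSurplus (B : BlockBuildingProcess Advice Bid) (q : ℕ → OnChainPlay Advice Bid n) (N : ℕ)
    (y : Fin n → ℝ) : ℝ :=
  (q (bestPlay B q N fun j => max (y j) 0)).surplus B fun j => max (y j) 0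

variable (q : ℕ → OnChainPlay Advice Bid n) (N : ℕ)

/-- The virtual surplus of the values up to `d` is the best one if no value exceeds `d`, and is
bounded below in any case. -/
lemma surplusRule_bound (hreg : IsRegular D f) (hφ : virtualValue D f r ≤ 0)
    {v : Fin n → ℝ} (hv : ∀ i, 0 < cdf D (v i)) {C : ℝ}
    (hC : ∑ k ∈ Finset.range (N + 1), |(q k).burnt B| ≤ C) :
    {v : Fin n → ℝ | ∀ i, v i ≤ d}.indicator
        (fun v => bestSurplus B q N (fun j => virtualValue D f (v j)) + C) v - C ≤
      ∑ i, (Iic d).indicator (virtualValue D f) (v i)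
          * (surplusRule B q N (cappedVirtualValue D f r d H) v).userAlloc B i
        - (surplusRule B q N (cappedVirtualValue D f r d H) v).burnt B := by
  set ψ := cappedVirtualValue D f r d H with hψ
  have hψle : ∀ i, v i ≤ d → ψ (v i) = max (virtualValue D f (v i)) 0 := fun i h =>
    hreg.cappedVirtualValue_of_le hφ (hv i) h
  by_cases hbox : v ∈ {v : Fin n → ℝ | ∀ i, v i ≤ d}
  · rw [indicator_of_mem hbox]
    have h1 : (fun j => ψ (v j)) = fun j => max (virtualValue D f (v j)) 0 :=
      funext fun j => hψle j (hbox j)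
    have h2 : {j | 0 < ψ (v j)} = {j | 0 < virtualValue D f (v j)} := by
      ext j
      simp [hψle j (hbox j)]
    have h3 := (q (bestPlay B q N fun j => ψ (v j))).surplus_censor_pos B
      fun j => virtualValue D f (v j)
    rw [← h2] at h3
    have h4 : ∀ i, (Iic d).indicator (virtualValue D f) (v i) = virtualValue D f (v i) := fun i =>
      indicator_of_mem (by exact hbox i) _
    simp only [h4]
    rw [bestSurplus, ← h1]
    rw [← h1] at h3
    rw [← h3, add_sub_cancel_right]
    exact le_rfl
  · rw [indicator_of_notMem hbox, zero_sub]
    have h1 := (le_abs_self _).trans ((abs_burnt_surplusRule_le B q N ψ v).trans hC)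
    have h2 : 0 ≤ ∑ i, (Iic d).indicator (virtualValue D f) (v i)
        * (surplusRule B q N ψ v).userAlloc B i := by
      refine Finset.sum_nonneg fun i _ => ?_
      by_cases hi : v i ≤ d
      · rw [indicator_of_mem (by exact hi), userAlloc_surplusRule]
        split_ifs with h
        · rw [hψle i hi] at h
          have h' : 0 < virtualValue D f (v i) := by simpa using h
          exact mul_nonneg h'.le (OnChainPlay.userAlloc_nonneg B _ _)
        · rw [mul_zero]
      · rw [indicator_of_notMem (by exact hi), zero_mul]
    linarith

lemma measurableSet_forall_le (d : ℝ) : MeasurableSet {v : Fin n → ℝ | ∀ i, v i ≤ d} := by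
  rw [ofPred_forall]
  exact MeasurableSet.iInter fun i => measurableSet_le (measurable_pi_apply i) measurable_const

/-- With a sufficient raise `H`, a user with value above `d` gets nearly the largest allocation that
is possible for him within `q 0, …, q N`, unless there is another user with value above `d`. -/
lemma le_ruleAlloc_surplusRule [IsProbabilityMeasure D] (hreg : IsRegular D f)
    (hφ : virtualValue D f r ≤ 0) (hr0 : 0 < cdf D r) (hrd : r ≤ d) {C ε σ : ℝ} (hε : 0 < ε)
    (hC : ∑ k ∈ Finset.range (N + 1), |(q k).burnt B| ≤ C) (hσ1 : σ ≤ 1) (i : Fin n) {k₀ : ℕ}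
    (hk₀ : k₀ ≤ N) (hσ : σ - ε ≤ (q k₀).userAlloc B i)
    (hH : H = (n * max (virtualValue D f d) 0 + 2 * C) / ε + 1) :
    σ - 2 * ε - (1 - (profileLaw D n).real {v | ∀ i, v i ≤ d}) ≤
      ruleAlloc B D (surplusRule B q N (cappedVirtualValue D f r d H)) i (d + 1) := by
  set ψ := cappedVirtualValue D f r d H with hψ
  set b := max (virtualValue D f d) 0 with hb
  have hb0 : 0 ≤ b := le_max_right _ _
  have hburn : ∀ k ≤ N, |(q k).burnt B| ≤ C := fun k hk =>
    (Finset.single_le_sum (f := fun k => |(q k).burnt B|) (fun _ _ => abs_nonneg _)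
      (Finset.mem_range.2 (Nat.lt_succ_of_le hk))).trans hC
  have hC0 : 0 ≤ C := (abs_nonneg _).trans (hburn 0 (Nat.zero_le _))
  have hH0 : 0 < H := by
    rw [hH]
    positivity
  have hmono : Monotone ψ := hreg.monotone_cappedVirtualValue hr0 hrd hH0.le
  have hψ0 : ∀ v, 0 ≤ ψ v := fun v => by
    rcases lt_or_ge v r with h | h
    · exact (cappedVirtualValue_of_lt hrd h).ge
    · refine add_nonneg ?_ ?_
      · split_ifs
        · exact le_rfl
        · exact le_max_right _ _
      · split_ifs
        · exact hH0.le
        · exact le_rfl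
  have hψd : ψ (d + 1) = b + H := cappedVirtualValue_of_gt hrd (lt_add_one d)
  have hψd' : ψ d = b :=
    hreg.cappedVirtualValue_of_le hφ (hr0.trans_le (monotone_cdf D hrd)) le_rfl
  have hbox := measurableSet_forall_le (n := n) d
  have hpt : ∀ v : Fin n → ℝ, σ - 2 * ε - 1 + {v : Fin n → ℝ | ∀ i, v i ≤ d}.indicator 1 v ≤
      (surplusRule B q N ψ (Function.update v i (d + 1))).userAlloc B i := by
    intro v
    by_cases hv : v ∈ {v : Fin n → ℝ | ∀ i, v i ≤ d}
    swap
    · rw [indicator_of_notMem hv]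
      linarith [(surplusRule B q N ψ (Function.update v i (d + 1))).userAlloc_nonneg B i]
    rw [indicator_of_mem hv, Pi.one_apply, userAlloc_surplusRule, Function.update_self, hψd]
    have hpos : 0 < b + H := by linarith
    rw [if_pos hpos]
    set y : Fin n → ℝ := fun j => ψ (Function.update v i (d + 1) j) with hy
    set k := bestPlay B q N y with hk
    have hyi : y i = b + H := by simp only [hy, Function.update_self, hψd]
    have hyj : ∀ j ∈ Finset.univ.erase i, y j ≤ b := by
      intro j hj
      simp only [hy, Function.update_of_ne (Finset.ne_of_mem_erase hj)]
      exact hψd' ▸ hmono (hv j)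
    have hsplit : ∀ p : OnChainPlay Advice Bid n, p.surplus B y =
        y i * p.userAlloc B i + ∑ j ∈ Finset.univ.erase i, y j * p.userAlloc B j - p.burnt B := by
      intro p
      rw [OnChainPlay.surplus, Finset.add_sum_erase _ (fun j => y j * p.userAlloc B j)
        (Finset.mem_univ i)]
    have hub : ∑ j ∈ Finset.univ.erase i, y j * (q k).userAlloc B j ≤ n * b := by
      calc ∑ j ∈ Finset.univ.erase i, y j * (q k).userAlloc B j
          ≤ ∑ j ∈ Finset.univ.erase i, b := Finset.sum_le_sum fun j hj => by
            calc y j * (q k).userAlloc B j ≤ b * 1 :=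
                  mul_le_mul (hyj j hj) ((q k).userAlloc_le_one B j)
                    ((q k).userAlloc_nonneg B j) hb0
              _ = b := mul_one b
        _ ≤ n * b := by
            rw [Finset.sum_const, nsmul_eq_mul]
            refine mul_le_mul_of_nonneg_right ?_ hb0
            exact_mod_cast (Finset.card_le_univ _).trans_eq (Fintype.card_fin n)
    have hlb : 0 ≤ ∑ j ∈ Finset.univ.erase i, y j * (q k₀).userAlloc B j :=
      Finset.sum_nonneg fun j _ => mul_nonneg (hψ0 _) ((q k₀).userAlloc_nonneg B j)
    have hbest := surplus_le_bestPlay B q hk₀ y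
    rw [← hk, hsplit, hsplit, hyi] at hbest
    have h1 := abs_le.1 (hburn k (bestPlay_le B q N y))
    have h2 := abs_le.1 (hburn k₀ hk₀)
    have h3 : (b + H) * ((q k₀).userAlloc B i - (q k).userAlloc B i) ≤ H * ε := by
      have : H * ε = n * b + 2 * C + ε := by
        rw [hH]
        field_simp
      rw [this]
      linarith
    have h4 : (q k₀).userAlloc B i - (q k).userAlloc B i ≤ ε := by
      by_contra hcon
      have h5 := mul_lt_mul_of_pos_left (not_le.1 hcon) hpos
      have h6 := mul_nonneg hb0 hε.le
      linarith
    linarith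
  have hm : Measurable fun v : Fin n → ℝ =>
      (surplusRule B q N ψ (Function.update v i (d + 1))).userAlloc B i :=
    (measurable_userAlloc_surplusRule B q N hmono.measurable i).comp measurable_update_left
  have hind : Integrable ({v : Fin n → ℝ | ∀ i, v i ≤ d}.indicator (1 : (Fin n → ℝ) → ℝ))
      (profileLaw D n) := (integrable_const (1 : ℝ)).indicator hbox
  have := integral_mono (μ := profileLaw D n) ((integrable_const (σ - 2 * ε - 1)).add hind)
    (Integrable.of_bound hm.aestronglyMeasurable 1 (Eventually.of_forall fun v => abs_le.2
      ⟨by linarith [(surplusRule B q N ψ (Function.update v i (d + 1))).userAlloc_nonneg B i],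
        OnChainPlay.userAlloc_le_one B _ i⟩)) hpt
  simp only [Pi.add_apply] at this
  rw [integral_add (integrable_const _) hind, integral_const, integral_indicator_one hbox] at this
  simp only [probReal_univ, one_smul] at this
  unfold ruleAlloc
  linarith

lemma IsRegular.isTruthfulRule_surplusRule (hreg : IsRegular D f) (hr0 : 0 < cdf D r)
    (hrd : r ≤ d) (hH : 0 ≤ H) :
    IsTruthfulRule B D r (surplusRule B q N (cappedVirtualValue D f r d H)) := by
  have := hreg.prob
  have hmono := hreg.monotone_cappedVirtualValue hr0 hrd hH
  have hzero : ∀ i, ∀ v < r,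
      ruleAlloc B D (surplusRule B q N (cappedVirtualValue D f r d H)) i v = 0 := fun i v hv =>
    ruleAlloc_eq_zero q N i (cappedVirtualValue_of_lt hrd hv).le
  refine ⟨measurable_userAlloc_surplusRule B q N hmono.measurable,
    Integrable.of_bound (measurable_burnt_surplusRule B q N hmono.measurable).aestronglyMeasurable _
      (Eventually.of_forall (abs_burnt_surplusRule_le B q N _)),
    isMonotoneAlloc_ruleAlloc q N hmono, hzero, fun i => ?_⟩
  exact (hreg.integral_envelopePay_of_flat (isMonotoneAlloc_ruleAlloc q N hmono i) hr0 (hzero i) hrd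
    fun v hv => ruleAlloc_congr q N i (y := v) (z := d + 1) (by
      rw [cappedVirtualValue_of_gt hrd hv, cappedVirtualValue_of_gt hrd (lt_add_one d)])).1

lemma IsRegular.integrable_max_virtualValue (hreg : IsRegular D f) (hr0 : 0 < cdf D r)
    (hφ : virtualValue D f r ≤ 0) :
    Integrable (fun v => max (virtualValue D f v) 0) D := by
  have h : IntegrableOn (fun v => max (virtualValue D f v) 0) (Ici r) D :=
    (hreg.integrableOn_virtualValue_Ici hr0).pos_part
  rw [← integrable_indicator_iff measurableSet_Ici] at h
  refine h.congr ?_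
  filter_upwards [hreg.ae_mem_support_and_cdf_pos] with v hv
  by_cases hrv : r ≤ v
  · rw [indicator_of_mem (by exact hrv)]
  · rw [indicator_of_notMem (by exact hrv)]
    exact (max_eq_right ((hreg.virtualValue_mono hv.2 (not_le.1 hrv).le).trans hφ)).symm

lemma IsRegular.integrable_sum_max_virtualValue (hreg : IsRegular D f) (hr0 : 0 < cdf D r)
    (hφ : virtualValue D f r ≤ 0) :
    Integrable (fun v : Fin n → ℝ => ∑ i, max (virtualValue D f (v i)) 0) (profileLaw D n) := by
  have := hreg.prob
  exact integrable_finsetSum _ fun i _ =>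
    (measurePreserving_eval (fun _ : Fin n => D) i).integrable_comp_of_integrable
      (hreg.integrable_max_virtualValue hr0 hφ)

lemma bestSurplus_le (hB : IsBurnBounded B n) (y : Fin n → ℝ) :
    bestSurplus B q N y ≤ indirectUtility B n y := by
  rw [← hB.indirectUtility_max_zero]
  exact hB.surplus_le _ _

lemma measurable_bestSurplus : Measurable (bestSurplus B q N) := by
  have h1 : Measurable fun y : Fin n → ℝ => fun j => max (y j) 0 :=
    measurable_pi_lambda _ fun j => (measurable_pi_apply j).max measurable_const
  exact (measurable_surplus_bestPlay B q N).comp h1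

lemma abs_bestSurplus_le (y : Fin n → ℝ) :
    |bestSurplus B q N y| ≤ ∑ i, max (y i) 0 + ∑ k ∈ Finset.range (N + 1), |(q k).burnt B| := by
  set p := q (bestPlay B q N fun j => max (y j) 0) with hp
  have h1 : |p.burnt B| ≤ ∑ k ∈ Finset.range (N + 1), |(q k).burnt B| :=
    Finset.single_le_sum (f := fun k => |(q k).burnt B|) (fun _ _ => abs_nonneg _)
      (Finset.mem_range.2 (Nat.lt_succ_of_le (bestPlay_le B q N _)))
  have h2 := p.surplus_le_sum_max B fun j => max (y j) 0
  have h3 : -p.burnt B ≤ p.surplus B fun j => max (y j) 0 := by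
    have : 0 ≤ ∑ i, max (y i) 0 * p.userAlloc B i :=
      Finset.sum_nonneg fun i _ => mul_nonneg (le_max_right _ _) (p.userAlloc_nonneg B i)
    rw [OnChainPlay.surplus]
    linarith
  have h4 : 0 ≤ ∑ i, max (y i) 0 := Finset.sum_nonneg fun i _ => le_max_right _ _
  have h5 := abs_le.1 h1
  simp only [max_eq_left (le_max_right _ (0 : ℝ))] at h2
  rw [bestSurplus, ← hp, abs_le]
  constructor <;> linarith

lemma IsRegular.integrable_bestSurplus (hreg : IsRegular D f) (hr0 : 0 < cdf D r)
    (hφ : virtualValue D f r ≤ 0) :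
    Integrable (fun v : Fin n → ℝ => bestSurplus B q N fun j => virtualValue D f (v j))
      (profileLaw D n) := by
  have := hreg.prob
  have hm : Measurable fun v : Fin n → ℝ => fun j => virtualValue D f (v j) :=
    measurable_pi_lambda _ fun j => hreg.measurable_virtualValue.comp (measurable_pi_apply j)
  refine ((hreg.integrable_sum_max_virtualValue hr0 hφ).add (integrable_const
    (∑ k ∈ Finset.range (N + 1), |(q k).burnt B|))).mono'
    ((measurable_bestSurplus q N).comp hm).aestronglyMeasurable
    (Eventually.of_forall fun v => abs_bestSurplus_le q N _)

/-- The revenue of the truthful mechanism that maximizes the capped virtual surplus. -/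
lemma IsRegular.le_expectedRevenue_surplusRule (hreg : IsRegular D f) (hr0 : 0 < cdf D r)
    (hφ : virtualValue D f r ≤ 0) (hrd : r ≤ d) (hH : 0 ≤ H) {C : ℝ}
    (hC : ∑ k ∈ Finset.range (N + 1), |(q k).burnt B| ≤ C) :
    ∫ v in {v : Fin n → ℝ | ∀ i, v i ≤ d},
        (bestSurplus B q N (fun j => virtualValue D f (v j)) + C) ∂(profileLaw D n) - C
      + ∑ i, (1 - cdf D d) * (d *
          ruleAlloc B D (surplusRule B q N (cappedVirtualValue D f r d H)) i (d + 1)) ≤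
      (directMechanism B D r (surplusRule B q N (cappedVirtualValue D f r d H))).expectedRevenue
        B D (fun _ z => z) := by
  have := hreg.prob
  set P := surplusRule B q N (cappedVirtualValue D f r d H) with hPdef
  have hP : IsTruthfulRule B D r P := hreg.isTruthfulRule_surplusRule q N hr0 hrd hH
  set h : ℝ → ℝ := (Iic d).indicator (virtualValue D f) with hh
  have hhm : Measurable h := hreg.measurable_virtualValue.indicator measurableSet_Iic
  have hflat : ∀ i v, d < v → ruleAlloc B D P i v = ruleAlloc B D P i (d + 1) := fun i v hv =>
    ruleAlloc_congr q N i (by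
      rw [cappedVirtualValue_of_gt hrd hv, cappedVirtualValue_of_gt hrd (lt_add_one d)])
  -- the virtual surplus of user `i` on values up to `d`
  have hint : ∀ i, Integrable (fun z => h z * ruleAlloc B D P i z) D := by
    intro i
    have h1 : Integrable ((Icc r d).indicator (virtualValue D f)) D :=
      (integrable_indicator_iff measurableSet_Icc).2
        ((hreg.integrableOn_virtualValue_Ici hr0).mono_set Icc_subset_Ici_self)
    refine (h1.mul_bdd (c := 1) (hP.monotone i).mono.measurable.aestronglyMeasurable
      (Eventually.of_forall (hP.monotone i).abs_le_one)).congr (Eventually.of_forall fun z => ?_)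
    simp only [hh]
    rcases lt_or_ge z r with hz | hz
    · rw [hP.eq_zero i z hz, mul_zero, mul_zero]
    · by_cases hzd : z ≤ d
      · rw [indicator_of_mem (by exact ⟨hz, hzd⟩), indicator_of_mem (by exact hzd)]
      · rw [indicator_of_notMem fun h => hzd h.2, indicator_of_notMem (by exact hzd)]
  have hint' : ∀ i, Integrable (fun v : Fin n → ℝ => h (v i) * (P v).userAlloc B i)
      (profileLaw D n) := fun i =>
    integrable_mul_of_interim i (hP.integrable_alloc i) (fun v => (P v).userAlloc_nonneg B i) hhm
      (hint i)
  have hpay : ∀ i, ∫ z, envelopePay r 0 (ruleAlloc B D P i) z ∂D =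
      ∫ v, h (v i) * (P v).userAlloc B i ∂(profileLaw D n)
        + (1 - cdf D d) * (d * ruleAlloc B D P i (d + 1)) := by
    intro i
    rw [(hreg.integral_envelopePay_of_flat (hP.monotone i) hr0 (hP.eq_zero i) hrd (hflat i)).2,
      integral_mul_eq_interim i (hint' i), ← integral_indicator measurableSet_Iic]
    congr 1
    refine integral_congr_ae (Eventually.of_forall fun z => ?_)
    simp only [hh, ruleAlloc]
    by_cases hz : z ∈ Iic d
    · rw [indicator_of_mem hz, indicator_of_mem hz]
    · rw [indicator_of_notMem hz, indicator_of_notMem hz, zero_mul]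
  have hbox := measurableSet_forall_le (n := n) d
  have hbi : Integrable
      (fun v : Fin n → ℝ => bestSurplus B q N (fun j => virtualValue D f (v j)) + C)
      (profileLaw D n) := (hreg.integrable_bestSurplus q N hr0 hφ).add (integrable_const C)
  have hbound := integral_mono_ae (μ := profileLaw D n)
    ((hbi.indicator hbox).sub (integrable_const C))
    ((integrable_finsetSum _ fun i _ => hint' i).sub hP.integrable_burnt) (by
      have hpos : ∀ᵐ v ∂(profileLaw D n), ∀ i, 0 < cdf D (v i) := by
        rw [ae_all_iff]
        intro i
        exact (measurePreserving_eval (fun _ : Fin n => D) i).quasiMeasurePreserving.ae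
          (hreg.ae_mem_support_and_cdf_pos.mono fun v hv => hv.2)
      filter_upwards [hpos] with v hv
      exact surplusRule_bound q N hreg hφ hv hC)
  simp only [Pi.sub_apply] at hbound
  rw [integral_sub (hbi.indicator hbox) (integrable_const C), integral_indicator hbox,
    integral_const, integral_sub (integrable_finsetSum _ fun i _ => hint' i) hP.integrable_burnt,
    integral_finsetSum _ fun i _ => hint' i] at hbound
  rw [hP.expectedRevenue_eq, Finset.sum_congr rfl fun i _ => hpay i, Finset.sum_add_distrib]
  simp only [probReal_univ, one_smul] at hbound
  linarith

end NearlyOptimal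

/-! ### Revenue-optimal equilibria maximize the virtual surplus -/

section Optimality

variable {Advice : Type*} {Bid : Type*} {n : ℕ} {B : BlockBuildingProcess Advice Bid}
  {D : Measure ℝ} {f : ℝ → ℝ} {r : ℝ}

/-- A value that can serve as a reserve price. -/
lemma IsRegular.exists_reserve (hreg : IsRegular D f) (hsmooth : IsSmooth D f) :
    ∃ r ∈ D.support, 0 < cdf D r ∧ virtualValue D f r ≤ 0 := by
  by_contra! hcon
  refine hsmooth.nonpos_pos.ne' (measure_eq_zero_iff_ae_notMem.2 ?_)
  filter_upwards [hreg.ae_mem_support_and_cdf_pos] with v hv hle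
  exact (hcon v hv.1 hv.2).not_ge hle

lemma aecover_forall_le [IsProbabilityMeasure D] :
    AECover (profileLaw D n) atTop fun k : ℕ => {v : Fin n → ℝ | ∀ i, v i ≤ k} := by
  refine ⟨Eventually.of_forall fun v => ?_, fun k => measurableSet_forall_le _⟩
  refine eventually_all.2 fun i => ?_
  exact (tendsto_natCast_atTop_atTop (R := ℝ)).eventually_ge_atTop (v i)

lemma IsBurnBounded.abs_indirectUtility_le (hB : IsBurnBounded B n) (y : Fin n → ℝ) :
    |indirectUtility B n y| ≤ ∑ i, max (y i) 0 + |indirectUtility B n 0| := by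
  have h1 : indirectUtility B n 0 ≤ indirectUtility B n y := by
    rw [← hB.indirectUtility_max_zero y]
    exact hB.monotone_indirectUtility fun i => le_max_right _ _
  have h2 := hB.indirectUtility_le_sub_add 0 fun i => max (y i) 0
  rw [hB.indirectUtility_max_zero] at h2
  simp only [Pi.zero_apply, sub_zero, abs_of_nonneg (le_max_right _ (0 : ℝ))] at h2
  have h3 : 0 ≤ ∑ i, max (y i) 0 := Finset.sum_nonneg fun i _ => le_max_right _ _
  rw [abs_le]
  constructor
  · linarith [neg_abs_le (indirectUtility B n 0)]
  · linarith [le_abs_self (indirectUtility B n 0)]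

lemma IsRegular.measurable_virtualValues (hreg : IsRegular D f) :
    Measurable fun v : Fin n → ℝ => fun j => virtualValue D f (v j) :=
  measurable_pi_lambda _ fun j => hreg.measurable_virtualValue.comp (measurable_pi_apply j)

lemma IsRegular.integrable_indirectUtility (hreg : IsRegular D f) (hr0 : 0 < cdf D r)
    (hφ : virtualValue D f r ≤ 0) (hB : IsBurnBounded B n) :
    Integrable (fun v : Fin n → ℝ => indirectUtility B n fun j => virtualValue D f (v j))
      (profileLaw D n) := by
  have := hreg.prob
  exact ((hreg.integrable_sum_max_virtualValue hr0 hφ).add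
    (integrable_const |indirectUtility B n 0|)).mono'
    (hB.continuous_indirectUtility.measurable.comp
      hreg.measurable_virtualValues).aestronglyMeasurable
    (Eventually.of_forall fun v => hB.abs_indirectUtility_le _)

lemma tendsto_bestSurplus (hB : IsBurnBounded B n) {q : ℕ → OnChainPlay Advice Bid n}
    (hq : HasDenseOutcomes B q) (y : Fin n → ℝ) :
    Tendsto (fun N => bestSurplus B q N y) atTop (𝓝 (indirectUtility B n y)) := by
  refine tendsto_order.2 ⟨fun a ha => ?_, fun a ha => ?_⟩
  · have := hB.nonempty
    rw [← hB.indirectUtility_max_zero y] at ha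
    obtain ⟨p, hp⟩ := exists_lt_of_lt_ciSup ha
    obtain ⟨k, hk⟩ := hq (fun o => ∑ i, max (y i) 0 * o.1 i - o.2) (by fun_prop) p a hp
    filter_upwards [eventually_ge_atTop k] with N hN
    exact hk.trans_le (surplus_le_bestPlay B q hN _)
  · exact Eventually.of_forall fun N => (bestSurplus_le q N hB y).trans_lt ha

lemma IsRegular.tendsto_integral_bestSurplus (hreg : IsRegular D f) (hr0 : 0 < cdf D r)
    (hφ : virtualValue D f r ≤ 0) (hB : IsBurnBounded B n) {q : ℕ → OnChainPlay Advice Bid n}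
    (hq : HasDenseOutcomes B q) :
    Tendsto (fun N => ∫ v : Fin n → ℝ, bestSurplus B q N (fun j => virtualValue D f (v j))
        ∂(profileLaw D n)) atTop
      (𝓝 (∫ v : Fin n → ℝ, indirectUtility B n (fun j => virtualValue D f (v j))
        ∂(profileLaw D n))) := by
  have := hreg.prob
  refine tendsto_integral_of_dominated_convergence
    (fun v => ∑ i, max (virtualValue D f (v i)) 0 + (|indirectUtility B n 0| + |(q 0).burnt B|))
    (fun N => (hreg.integrable_bestSurplus q N hr0 hφ).aestronglyMeasurable)
    ((hreg.integrable_sum_max_virtualValue hr0 hφ).add (integrable_const _))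
    (fun N => Eventually.of_forall fun v => ?_)
    (Eventually.of_forall fun v => tendsto_bestSurplus hB hq _)
  set y : Fin n → ℝ := fun j => virtualValue D f (v j) with hy
  have h1 := bestSurplus_le q N hB y
  have h2 := (abs_le.1 (hB.abs_indirectUtility_le y)).2
  have h3 := surplus_le_bestPlay B q (Nat.zero_le N) fun j => max (y j) 0
  have h4 : -(q 0).burnt B ≤ (q 0).surplus B fun j => max (y j) 0 := by
    have : 0 ≤ ∑ i, max (y i) 0 * (q 0).userAlloc B i :=
      Finset.sum_nonneg fun i _ => mul_nonneg (le_max_right _ _) ((q 0).userAlloc_nonneg B i)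
    rw [OnChainPlay.surplus]
    linarith
  have h5 : 0 ≤ ∑ i, max (y i) 0 := Finset.sum_nonneg fun i _ => le_max_right _ _
  rw [Real.norm_eq_abs, abs_le]
  constructor
  · change -(∑ i, max (y i) 0 + (|indirectUtility B n 0| + |(q 0).burnt B|)) ≤
      (q (bestPlay B q N fun j => max (y j) 0)).surplus B fun j => max (y j) 0
    linarith [abs_nonneg (indirectUtility B n 0), le_abs_self ((q 0).burnt B)]
  · change bestSurplus B q N y ≤ ∑ i, max (y i) 0 + (|indirectUtility B n 0| + |(q 0).burnt B|)
    linarith [abs_nonneg ((q 0).burnt B)]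

variable {M : OffChainMechanism Advice Bid n} {s : ∀ i, ℝ → M.Msg i}

/-- The single-agent description of an equilibrium: allocation functions and bottom utilities that
produce the expected payments and the expected virtual surplus. -/
lemma IsRegular.exists_envelope (hreg : IsRegular D f) (hr : r ∈ D.support)
    (hr0 : 0 < cdf D r) (hφ : virtualValue D f r ≤ 0) (hs : M.IsBNE B D s) (i : Fin n) :
    ∃ (x : ℝ → ℝ) (u₀ : ℝ), IsMonotoneAlloc x ∧
      (∀ v ∈ D.support, x v = interimAlloc B D M s i v) ∧
      (∀ v ∈ D.support, 0 < cdf D v → 0 ≤ envelopeUtility r u₀ x v) ∧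
      Integrable (envelopePay r u₀ x) D ∧
      ∫ v, envelopePay r u₀ x v ∂D = ∫ v, M.totalPay B (M.messages s v) i ∂(profileLaw D n) ∧
      Integrable (fun v => virtualValue D f v * x v) D ∧
      Integrable (fun v => virtualValue D f (v i) * (M.play (M.messages s v)).userAlloc B i)
        (profileLaw D n) ∧
      ∫ v, virtualValue D f v * x v ∂D =
        ∫ v, virtualValue D f (v i) * (M.play (M.messages s v)).userAlloc B i
          ∂(profileLaw D n) := by
  have := hreg.prob
  obtain ⟨x, u₀, hx, hxX, htT, hu⟩ := exists_isMonotoneAlloc hs hreg hr hr0 i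
  have hT : envelopePay r u₀ x =ᵐ[D] interimPay B D M s i := by
    filter_upwards [hreg.ae_mem_support_and_cdf_pos] with v hv using htT v hv.1 hv.2
  have hX : (fun v => virtualValue D f v * x v)
      =ᵐ[D] fun v => virtualValue D f v * interimAlloc B D M s i v := by
    filter_upwards [hreg.ae_mem_support_and_cdf_pos] with v hv
    rw [hxX v hv.1]
  have hti : Integrable (envelopePay r u₀ x) D :=
    (integrable_interim i (hs.pay_integrable i)).congr hT.symm
  have hφx := hreg.integrable_virtualValue_mul hx hr hr0 hφ hu hti
  have hφX := integrable_mul_of_interim i (hs.alloc_integrable i)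
    (fun v => OnChainPlay.userAlloc_nonneg B _ i) hreg.measurable_virtualValue (hφx.congr hX)
  refine ⟨x, u₀, hx, hxX, hu, hti, ?_, hφx, hφX, ?_⟩
  · rw [integral_congr_ae hT]
    exact integral_interim i (hs.pay_integrable i)
  · rw [integral_congr_ae hX, integral_mul_eq_interim i hφX]
    rfl

/-- No finite family of plays achieves a larger expected virtual surplus than a revenue-optimal
equilibrium, up to an error that vanishes as the family becomes dense. -/
lemma IsRegular.integral_bestSurplus_le (hreg : IsRegular D f) (hr : r ∈ D.support)
    (hr0 : 0 < cdf D r) (hφ : virtualValue D f r ≤ 0) (hopt : M.IsRevenueOptimal B D s)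
    {q : ℕ → OnChainPlay Advice Bid n}
    (hq : HasDenseOutcomes B q) {ε : ℝ} (hε : 0 < ε) :
    ∀ᶠ N in atTop, ∫ v : Fin n → ℝ, bestSurplus B q N (fun j => virtualValue D f (v j))
        ∂(profileLaw D n) ≤
      ∫ v, (M.play (M.messages s v)).surplus B (fun j => virtualValue D f (v j)) ∂(profileLaw D n)
        + n * ((|r| + |virtualValue D f r|) * (2 * ε)) := by
  have := hreg.prob
  have hs := hopt.1
  have hne : Nonempty (OnChainPlay Advice Bid n) := ⟨M.play (M.messages s 0)⟩
  choose x u₀ hx hxX hu hti hT hφx hφX hφeq using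
    fun i => hreg.exists_envelope hr hr0 hφ hs i
  set c₁ := |r| + |virtualValue D f r| with hc₁
  -- the largest allocation that user `i` may get
  set σ : Fin n → ℝ := fun i => ⨆ p : OnChainPlay Advice Bid n, p.userAlloc B i with hσ
  have hbdd : ∀ i, BddAbove (range fun p : OnChainPlay Advice Bid n => p.userAlloc B i) := fun i =>
    ⟨1, by rintro _ ⟨p, rfl⟩; exact p.userAlloc_le_one B i⟩
  have hσ1 : ∀ i, σ i ≤ 1 := fun i => ciSup_le fun p => p.userAlloc_le_one B i
  have hxσ : ∀ i, ∀ v ∈ D.support, x i v ≤ σ i := by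
    intro i v hv
    rw [hxX i v hv, interimAlloc]
    have hint : Integrable (fun w => (M.play (M.messages s (Function.update w i v))).userAlloc B i)
        (profileLaw D n) := by
      simpa only [messages_update] using hs.alloc_integrable_dev i (s i v)
    have := integral_mono hint (integrable_const (σ i)) fun w => le_ciSup (hbdd i) _
    simpa using this
  have hk : ∀ i, ∃ k, σ i - ε < (q k).userAlloc B i := by
    intro i
    obtain ⟨p, hp⟩ := exists_lt_of_lt_ciSup (sub_lt_self (σ i) hε)
    exact hq (fun o => o.1 i) (by fun_prop) p _ hp
  choose k₀ hk₀ using hk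
  filter_upwards [eventually_all.2 fun i => eventually_ge_atTop (k₀ i)] with N hN
  set C := ∑ k ∈ Finset.range (N + 1), |(q k).burnt B| with hC
  have hC0 : 0 ≤ C := Finset.sum_nonneg fun _ _ => abs_nonneg _
  set W : (Fin n → ℝ) → ℝ := fun v => bestSurplus B q N fun j => virtualValue D f (v j) with hW
  have hWi : Integrable W (profileLaw D n) := hreg.integrable_bestSurplus q N hr0 hφ
  have hrev : M.expectedRevenue B D s = ∑ i, ∫ v, envelopePay r (u₀ i) (x i) v ∂D
      - ∫ v, (M.play (M.messages s v)).burnt B ∂(profileLaw D n) := by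
    rw [OffChainMechanism.expectedRevenue, integral_sub
      (integrable_finsetSum _ fun i _ => hs.pay_integrable i) hs.burn_integrable,
      integral_finsetSum _ fun i _ => hs.pay_integrable i]
    simp only [hT]
  have hsurp : ∫ v, (M.play (M.messages s v)).surplus B (fun j => virtualValue D f (v j))
      ∂(profileLaw D n) = ∑ i, ∫ v, virtualValue D f v * x i v ∂D
        - ∫ v, (M.play (M.messages s v)).burnt B ∂(profileLaw D n) := by
    simp only [OnChainPlay.surplus]
    rw [integral_sub (integrable_finsetSum _ fun i _ => hφX i) hs.burn_integrable,
      integral_finsetSum _ fun i _ => hφX i]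
    simp only [hφeq]
  -- compare the revenues at a finite cap `d`
  set box : ℕ → Set (Fin n → ℝ) := fun k => {v | ∀ i, v i ≤ k} with hbox
  have hineq : ∀ᶠ k : ℕ in atTop,
      ∫ v in box k, (W v + C) ∂(profileLaw D n) - C ≤
        ∑ i, (∫ v in Iic (k : ℝ), virtualValue D f v * x i v ∂D
          + (1 - cdf D k) * (|u₀ i| + |r|) + ∫ v in Ioi (k : ℝ), envelopePay r (u₀ i) (x i) v ∂D
          + c₁ * (2 * ε + (1 - (profileLaw D n).real (box k))))
        - ∫ v, (M.play (M.messages s v)).burnt B ∂(profileLaw D n) := by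
    filter_upwards [(tendsto_natCast_atTop_atTop (R := ℝ)).eventually_ge_atTop r] with k hrk
    set d := (k : ℝ) with hd
    have hd0 : 0 ≤ d := Nat.cast_nonneg k
    -- the raise for which the competing mechanism loses at most `2 * ε` of the allocation `σ i`
    set H := (n * max (virtualValue D f d) 0 + 2 * C) / ε + 1 with hH
    have hH0 : 0 ≤ H := by
      have : 0 ≤ max (virtualValue D f d) 0 := le_max_right _ _
      positivity
    have h1 := hreg.le_expectedRevenue_surplusRule q N hr0 hφ hrk hH0 (le_refl C)
    have h2 := hopt.2 _ _ (hreg.isTruthfulRule_surplusRule (B := B) q N hr0 hrk hH0).isBNE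
    have h3 := h1.trans h2
    rw [hrev] at h3
    have hG0 : 0 ≤ (1 - cdf D d) := sub_nonneg.2 (cdf_le_one D d)
    have hoff : 0 ≤ 1 - (profileLaw D n).real (box k) := sub_nonneg.2 measureReal_le_one
    have h4 : ∀ i, ∫ v, envelopePay r (u₀ i) (x i) v ∂D ≤
        ∫ v in Iic d, virtualValue D f v * x i v ∂D
          + (1 - cdf D d) * (|u₀ i| + |r|) + ∫ v in Ioi d, envelopePay r (u₀ i) (x i) v ∂D
          + c₁ * (2 * ε + (1 - (profileLaw D n).real (box k)))
          + (1 - cdf D d) * (d *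
          ruleAlloc B D (surplusRule B q N (cappedVirtualValue D f r d H)) i (d + 1)) := by
      intro i
      have h5 := hreg.integral_envelopePay_le (hx i) hr hr0 hφ (hu i) (hti i) (hxσ i) hrk hd0
      have h6 := le_ruleAlloc_surplusRule q N hreg hφ hr0 hrk hε (le_refl C) (hσ1 i) i (hN i)
        (hk₀ i).le hH
      have h7 : (d * (1 - cdf D d)) * (σ i
          - ruleAlloc B D (surplusRule B q N (cappedVirtualValue D f r d H)) i (d + 1)) ≤
          (d * (1 - cdf D d)) * (2 * ε + (1 - (profileLaw D n).real (box k))) :=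
        mul_le_mul_of_nonneg_left (by linarith) (mul_nonneg hd0 hG0)
      have h8 : (d * (1 - cdf D d)) * (2 * ε + (1 - (profileLaw D n).real (box k))) ≤
          c₁ * (2 * ε + (1 - (profileLaw D n).real (box k))) :=
        mul_le_mul_of_nonneg_right (hreg.mul_one_sub_cdf_le hr0 hrk) (by positivity)
      linarith
    have h9 := Finset.sum_le_sum fun i (_ : i ∈ Finset.univ) => h4 i
    rw [Finset.sum_add_distrib] at h9
    linarith
  have hcov := aecover_forall_le (D := D) (n := n)
  have hIic : AECover D atTop fun k : ℕ => Iic (k : ℝ) := aecover_Iic tendsto_natCast_atTop_atTop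
  have hlim1 : Tendsto (fun k : ℕ => ∫ v in box k, (W v + C) ∂(profileLaw D n) - C) atTop
      (𝓝 (∫ v, W v ∂(profileLaw D n))) := by
    have h := (hcov.integral_tendsto_of_countably_generated
      (hWi.add (integrable_const C))).sub_const C
    have he : ∫ v, (W + fun _ => C : (Fin n → ℝ) → ℝ) v ∂(profileLaw D n) - C
        = ∫ v, W v ∂(profileLaw D n) := by
      rw [integral_add' hWi (integrable_const C)]
      simp
    rwa [he] at h
  have hlimbox : Tendsto (fun k : ℕ => (profileLaw D n).real (box k)) atTop (𝓝 1) := by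
    have h := hcov.integral_tendsto_of_countably_generated (integrable_const (1 : ℝ))
    simpa using h
  have hlimF : Tendsto (fun k : ℕ => cdf D (k : ℝ)) atTop (𝓝 1) :=
    (tendsto_cdf_atTop D).comp tendsto_natCast_atTop_atTop
  have hlimT : ∀ i, Tendsto (fun k : ℕ => ∫ v in Ioi (k : ℝ), envelopePay r (u₀ i) (x i) v ∂D)
      atTop (𝓝 0) := by
    intro i
    have h := (hIic.integral_tendsto_of_countably_generated (hti i)).const_sub
      (∫ v, envelopePay r (u₀ i) (x i) v ∂D)
    rw [sub_self] at h
    refine h.congr fun k => ?_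
    rw [← integral_add_compl (μ := D) (measurableSet_Iic (a := (k : ℝ))) (hti i), compl_Iic]
    ring
  have hlim2 := (tendsto_finsetSum Finset.univ fun i _ =>
    ((((hIic.integral_tendsto_of_countably_generated (hφx i)).add
      ((hlimF.const_sub 1).mul_const (|u₀ i| + |r|))).add (hlimT i)).add
      (((hlimbox.const_sub 1).const_add (2 * ε)).const_mul c₁))).sub_const
      (∫ v, (M.play (M.messages s v)).burnt B ∂(profileLaw D n))
  have hfin := le_of_tendsto_of_tendsto hlim1 hlim2 hineq
  rw [hsurp]
  simp only [sub_self, zero_mul, add_zero] at hfin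
  rw [Finset.sum_add_distrib, Finset.sum_const, Finset.card_univ, Fintype.card_fin,
    nsmul_eq_mul] at hfin
  linarith

/-- **Optimality.** Almost surely, a revenue-optimal equilibrium plays so as to maximize the virtual
surplus. -/
theorem IsRegular.ae_surplus_eq_indirectUtility (hreg : IsRegular D f) (hsmooth : IsSmooth D f)
    (hopt : M.IsRevenueOptimal B D s) :
    ∀ᵐ v ∂(profileLaw D n), (M.play (M.messages s v)).surplus B (fun j => virtualValue D f (v j))
      = indirectUtility B n fun j => virtualValue D f (v j) := by
  have := hreg.prob
  obtain ⟨r, hr, hr0, hφ⟩ := hreg.exists_reserve hsmooth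
  have hB := isBurnBounded_of_isRevenueOptimal hopt
  have hne := hB.nonempty
  obtain ⟨q, hq⟩ := exists_hasDenseOutcomes (Advice := Advice) (Bid := Bid) (n := n) (B := B)
  have hUi := hreg.integrable_indirectUtility hr0 hφ hB
  have hSi : Integrable (fun v =>
      (M.play (M.messages s v)).surplus B (fun j => virtualValue D f (v j))) (profileLaw D n) := by
    choose x u₀ hx hxX hu hti hT hφx hφX hφeq using
      fun i => hreg.exists_envelope hr hr0 hφ hopt.1 i
    exact (integrable_finsetSum _ fun i _ => hφX i).sub hopt.1.burn_integrable
  have hle : ∫ v : Fin n → ℝ, indirectUtility B n (fun j => virtualValue D f (v j))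
      ∂(profileLaw D n) ≤ ∫ v, (M.play (M.messages s v)).surplus B
        (fun j => virtualValue D f (v j)) ∂(profileLaw D n) := by
    have hε : ∀ ε > 0, ∫ v : Fin n → ℝ, indirectUtility B n (fun j => virtualValue D f (v j))
        ∂(profileLaw D n) ≤ ∫ v, (M.play (M.messages s v)).surplus B
          (fun j => virtualValue D f (v j)) ∂(profileLaw D n)
          + n * ((|r| + |virtualValue D f r|) * (2 * ε)) := fun ε hε =>
      le_of_tendsto (hreg.tendsto_integral_bestSurplus hr0 hφ hB hq)
        (hreg.integral_bestSurplus_le hr hr0 hφ hopt hq hε)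
    have hcont : Continuous fun ε : ℝ => ∫ v, (M.play (M.messages s v)).surplus B
          (fun j => virtualValue D f (v j)) ∂(profileLaw D n)
          + n * ((|r| + |virtualValue D f r|) * (2 * ε)) := by fun_prop
    have hlim := (hcont.tendsto 0).mono_left (nhdsWithin_le_nhds (s := Ioi 0))
    simp only [mul_zero, add_zero] at hlim
    exact ge_of_tendsto hlim (eventually_mem_nhdsWithin.mono fun ε h => hε ε h)
  have h0 : ∀ v, 0 ≤ indirectUtility B n (fun j => virtualValue D f (v j))
      - (M.play (M.messages s v)).surplus B (fun j => virtualValue D f (v j)) := fun v =>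
    sub_nonneg.2 (hB.surplus_le _ _)
  have hz := (integral_eq_zero_iff_of_nonneg h0 (hUi.sub hSi)).1 (by
    refine le_antisymm ?_ (integral_nonneg h0)
    rw [integral_sub hUi hSi]
    linarith)
  filter_upwards [hz] with v hv
  exact (sub_eq_zero.1 hv).symm

end Optimality

/-! ### Subgradients and gradients of convex functions -/

section Gradient

/-- A convex function on the line is differentiable up to countably many points. -/
lemma countable_not_differentiableAt_of_convexOn {g : ℝ → ℝ} (hg : ConvexOn ℝ univ g) :
    {t | ¬DifferentiableAt ℝ g t}.Countable := by
  set g' : ℝ → ℝ := fun t => derivWithin g (Ioi t) t with hg'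
  have hint : ∀ t, t ∈ interior (univ : Set ℝ) := by simp
  have hmono : Monotone g' := by
    have := hg.monotoneOn_rightDeriv
    rwa [interior_univ, monotoneOn_univ] at this
  have hlow : ∀ a b, a < b → g' a ≤ slope g a b := fun a b hab =>
    hg.rightDeriv_le_slope_of_mem_interior (hint a) (mem_univ b) hab
  have hupp : ∀ a b, a < b → slope g a b ≤ g' b := fun a b hab =>
    (hg.slope_le_leftDeriv_of_mem_interior (mem_univ a) (hint b) hab).trans
      (hg.leftDeriv_le_rightDeriv_of_mem_interior (hint b))
  refine hmono.countable_not_continuousAt.mono ?_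
  intro t ht hc
  apply ht
  suffices hderiv : HasDerivAt g (g' t) t from hderiv.differentiableAt
  rw [hasDerivAt_iff_tendsto_slope]
  have hc' : Tendsto g' (𝓝[≠] t) (𝓝 (g' t)) := hc.tendsto.mono_left nhdsWithin_le_nhds
  have hmin : Tendsto (fun z => min (g' z) (g' t)) (𝓝[≠] t) (𝓝 (g' t)) := by
    simpa using hc'.min (tendsto_const_nhds (x := g' t))
  have hmax : Tendsto (fun z => max (g' z) (g' t)) (𝓝[≠] t) (𝓝 (g' t)) := by
    simpa using hc'.max (tendsto_const_nhds (x := g' t))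
  refine tendsto_of_tendsto_of_tendsto_of_le_of_le' hmin hmax ?_ ?_
  · filter_upwards [self_mem_nhdsWithin] with z hz
    rcases lt_or_gt_of_ne hz with h | h
    · rw [slope_comm]
      exact (min_le_left _ _).trans (hlow z t h)
    · exact (min_le_right _ _).trans (hlow t z h)
  · filter_upwards [self_mem_nhdsWithin] with z hz
    rcases lt_or_gt_of_ne hz with h | h
    · rw [slope_comm]
      exact (hupp z t h).trans (le_max_right _ _)
    · exact (hupp t z h).trans (le_max_left _ _)

variable {n : ℕ} {U : (Fin n → ℝ) → ℝ} {g y : Fin n → ℝ}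

lemma convexOn_update (hU : ConvexOn ℝ univ U) (y : Fin n → ℝ) (i : Fin n) :
    ConvexOn ℝ univ fun t => U (Function.update y i t) := by
  refine ⟨convex_univ, fun s _ t _ a b ha hb hab => ?_⟩
  have : Function.update y i (a • s + b • t)
      = a • Function.update y i s + b • Function.update y i t := by
    ext j
    rcases eq_or_ne j i with rfl | hj
    · simp
    · simp only [Function.update_of_ne hj, Pi.add_apply, Pi.smul_apply, smul_eq_mul]
      rw [← add_mul, hab, one_mul]
  beta_reduce
  rw [this]
  exact hU.2 (mem_univ _) (mem_univ _) ha hb hab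

/-- A subgradient is the gradient, if there is one. -/
lemma IsSubgradientAt.isGradientAt (hg : IsSubgradientAt U g y) (hd : DifferentiableAt ℝ U y) :
    IsGradientAt U g y := by
  set G : (Fin n → ℝ) →L[ℝ] ℝ :=
    ∑ i, g i • ContinuousLinearMap.proj (R := ℝ) (φ := fun _ : Fin n => ℝ) i with hG
  have hGapp : ∀ z, G z = ∑ i, g i * z i := fun z => by
    simp [hG]
  have hmin : IsLocalMin (fun z => U z - G z) y := by
    refine Eventually.of_forall fun z => ?_
    have := hg z
    simp only [mul_sub, Finset.sum_sub_distrib, ← hGapp] at this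
    show U y - G y ≤ U z - G z
    linarith
  have h0 := hmin.hasFDerivAt_eq_zero (hd.hasFDerivAt.sub G.hasFDerivAt)
  have h1 : fderiv ℝ U y = G := sub_eq_zero.1 h0
  have h2 := hd.hasFDerivAt
  rw [h1] at h2
  exact h2

/-- A convex function with a subgradient and all partial derivatives at a point is differentiable
there: a step `z - y` is the average of the steps `n (z i - y i)` along the coordinate axes. -/
lemma IsSubgradientAt.isGradientAt_of_partial (hg : IsSubgradientAt U g y)
    (hU : ConvexOn ℝ univ U)
    (hd : ∀ i, DifferentiableAt ℝ (fun t => U (Function.update y i t)) (y i)) :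
    IsGradientAt U g y := by
  rcases Nat.eq_zero_or_pos n with rfl | hn
  · exact hg.isGradientAt (hasFDerivAt_of_subsingleton U y).differentiableAt
  have hn' : (0 : ℝ) < n := by exact_mod_cast hn
  have hpart : ∀ i, HasDerivAt (fun t => U (Function.update y i t)) (g i) (y i) := by
    intro i
    have hmin : IsLocalMin (fun t => U (Function.update y i t) - g i * t) (y i) := by
      refine Eventually.of_forall fun t => ?_
      have h := hg (Function.update y i t)
      rw [Finset.sum_eq_single_of_mem i (Finset.mem_univ i) fun j _ hj => by
        rw [Function.update_of_ne hj, sub_self, mul_zero], Function.update_self] at h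
      beta_reduce
      rw [Function.update_eq_self]
      linarith
    have h1 := (hd i).hasDerivAt
    have h0 := hmin.hasDerivAt_eq_zero (h1.sub ((hasDerivAt_id (y i)).const_mul (g i)))
    rw [mul_one, sub_eq_zero] at h0
    rwa [h0] at h1
  set R : Fin n → ℝ → ℝ := fun i t => U (Function.update y i t) - U y - (t - y i) * g i with hR
  have hRo : ∀ i, (R i) =o[𝓝 (y i)] fun t => t - y i := by
    intro i
    have := hasDerivAt_iff_isLittleO.1 (hpart i)
    simpa only [Function.update_eq_self, smul_eq_mul] using this
  have hstep : ∀ i, Tendsto (fun z : Fin n → ℝ => y i + n * (z i - y i)) (𝓝 y) (𝓝 (y i)) := by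
    intro i
    have : Continuous fun z : Fin n → ℝ => y i + n * (z i - y i) := by fun_prop
    simpa using this.tendsto y
  have hsum : (fun z : Fin n → ℝ => ∑ i, (n : ℝ)⁻¹ * R i (y i + n * (z i - y i)))
      =o[𝓝 y] fun z => z - y := by
    refine Asymptotics.IsLittleO.fun_sum fun i _ => ?_
    refine Asymptotics.IsLittleO.const_mul_left
      (f := fun z : Fin n → ℝ => R i (y i + n * (z i - y i))) ?_ _
    refine ((hRo i).comp_tendsto (hstep i)).trans_isBigO (k := fun z : Fin n → ℝ => z - y) ?_
    refine Asymptotics.IsBigO.of_bound n (Eventually.of_forall fun z => ?_)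
    simp only [Function.comp_apply, add_sub_cancel_left, norm_mul, Real.norm_natCast]
    exact mul_le_mul_of_nonneg_left (norm_le_pi_norm (z - y) i) hn'.le
  rw [IsGradientAt, hasFDerivAt_iff_isLittleO]
  refine Asymptotics.IsBigO.trans_isLittleO ?_ hsum
  refine Asymptotics.IsBigO.of_bound 1 (Eventually.of_forall fun z => ?_)
  have hlin : (∑ i, g i • ContinuousLinearMap.proj (R := ℝ) (φ := fun _ : Fin n => ℝ) i) (z - y)
      = ∑ i, g i * (z i - y i) := by
    simp
  have hlow := hg z
  have hupp : U z ≤ ∑ i, (n : ℝ)⁻¹ * U (Function.update y i (y i + n * (z i - y i))) := by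
    have hz : ∑ i, (n : ℝ)⁻¹ • Function.update y i (y i + n * (z i - y i)) = z := by
      ext j
      rw [Finset.sum_apply]
      have : ∀ i, ((n : ℝ)⁻¹ • Function.update y i (y i + n * (z i - y i))) j
          = (n : ℝ)⁻¹ * y j + if i = j then z j - y j else 0 := by
        intro i
        rcases eq_or_ne i j with rfl | hj
        · simp only [Pi.smul_apply, Function.update_self, smul_eq_mul, if_true]
          field_simp
        · simp [Function.update_of_ne hj.symm, hj]
      simp only [this, Finset.sum_add_distrib, Finset.sum_const, Finset.card_univ,
        Fintype.card_fin, nsmul_eq_mul, Finset.sum_ite_eq', Finset.mem_univ, if_true]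
      field_simp
      ring
    have h := hU.map_sum_le (t := Finset.univ) (w := fun _ : Fin n => (n : ℝ)⁻¹)
      (p := fun i => Function.update y i (y i + n * (z i - y i)))
      (fun _ _ => by positivity) (by simp [hn'.ne']) fun _ _ => mem_univ _
    rw [hz] at h
    exact h
  have hRsum : ∑ i, (n : ℝ)⁻¹ * R i (y i + n * (z i - y i))
      = ∑ i, (n : ℝ)⁻¹ * U (Function.update y i (y i + n * (z i - y i))) - U y
        - ∑ i, g i * (z i - y i) := by
    have : ∀ i, (n : ℝ)⁻¹ * R i (y i + n * (z i - y i))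
        = (n : ℝ)⁻¹ * U (Function.update y i (y i + n * (z i - y i))) - (n : ℝ)⁻¹ * U y
          - g i * (z i - y i) := by
      intro i
      simp only [hR]
      field_simp
      ring
    simp only [this, Finset.sum_sub_distrib, Finset.sum_const, Finset.card_univ, Fintype.card_fin,
      nsmul_eq_mul]
    field_simp
  rw [hlin, hRsum, one_mul, Real.norm_of_nonneg (by linarith), Real.norm_of_nonneg (by linarith)]
  linarith

/-- For independent coordinates without atoms, a convex function has all partial derivatives almost
surely. -/
lemma ae_forall_differentiableAt_update {D : Measure ℝ} [IsProbabilityMeasure D] {φ : ℝ → ℝ}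
    (hφ : Measurable φ) (hatom : ∀ c, D {x | φ x = c} = 0) (hU : ConvexOn ℝ univ U)
    (hc : Continuous U) :
    ∀ᵐ v ∂(profileLaw D n), ∀ i,
      DifferentiableAt ℝ (fun t => U (Function.update (fun j => φ (v j)) i t)) (φ (v i)) := by
  rw [ae_all_iff]
  intro i
  set A : Set (Fin n → ℝ) :=
    {y | ¬DifferentiableAt ℝ (fun t => U (Function.update y i t)) (y i)} with hA
  have hAm : MeasurableSet A := by
    have hcont : Continuous (Function.uncurry fun (y : Fin n → ℝ) (t : ℝ) =>
        U (Function.update y i t)) :=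
      hc.comp (continuous_fst.update i continuous_snd)
    have h := (measurableSet_of_differentiableAt_with_param ℝ hcont).compl
    exact (measurable_id.prodMk (measurable_pi_apply i)) h
  have hφm : Measurable fun v : Fin n → ℝ => fun j => φ (v j) :=
    measurable_pi_lambda _ fun j => hφ.comp (measurable_pi_apply j)
  have hEm : MeasurableSet ((fun (v : Fin n → ℝ) j => φ (v j)) ⁻¹' A) := hφm hAm
  suffices h0 : profileLaw D n ((fun (v : Fin n → ℝ) j => φ (v j)) ⁻¹' A) = 0 from
    (measure_eq_zero_iff_ae_notMem.1 h0).mono fun v hv => not_not.1 hv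
  have hp := measurePreserving_update (D := D) i
  rw [← hp.measure_preimage hEm.nullMeasurableSet, Measure.prod_apply_symm (hp.measurable hEm)]
  refine lintegral_eq_zero_of_ae_eq_zero (Eventually.of_forall fun v => ?_)
  -- for fixed values of the others, only countably many virtual values of `i` are bad
  set S : Set ℝ :=
    {t | ¬DifferentiableAt ℝ (fun t => U (Function.update (fun j => φ (v j)) i t)) t} with hS
  have hScount : S.Countable := countable_not_differentiableAt_of_convexOn (convexOn_update hU _ i)
  have hsub : (fun z => (z, v)) ⁻¹' ((fun p : ℝ × (Fin n → ℝ) => Function.update p.2 i p.1) ⁻¹'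
      ((fun (v : Fin n → ℝ) j => φ (v j)) ⁻¹' A)) ⊆ ⋃ c ∈ S, {x | φ x = c} := by
    intro z hz
    have hupd : (fun j => φ (Function.update v i z j))
        = Function.update (fun j => φ (v j)) i (φ z) := by
      ext j
      rcases eq_or_ne j i with rfl | hj
      · simp
      · simp [Function.update_of_ne hj]
    simp only [mem_preimage, hupd, hA, mem_ofPred_eq, Function.update_idem,
      Function.update_self] at hz
    exact mem_biUnion (x := φ z) hz rfl
  exact measure_mono_null hsub ((measure_biUnion_null_iff hScount).2 fun c _ => hatom c)

variable {Advice : Type*} {Bid : Type*} {B : BlockBuildingProcess Advice Bid}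

/-- The allocation of a play that maximizes the virtual surplus is a subgradient of the maximum. -/
lemma IsBurnBounded.isSubgradientAt (hB : IsBurnBounded B n) {p : OnChainPlay Advice Bid n}
    {y : Fin n → ℝ} (h : p.surplus B y = indirectUtility B n y) :
    IsSubgradientAt (indirectUtility B n) (p.userAlloc B) y := by
  intro z
  have := p.surplus_sub B y z
  linarith [hB.surplus_le p z]

end Gradient

end TFM

end

theorem mainTheorem1 {Advice : Type*} {Bid : Type*}
    (B : TFM.BlockBuildingProcess Advice Bid)
    (D : Measure ℝ) (f : ℝ → ℝ) (hreg : TFM.IsRegular D f) (hsmooth : TFM.IsSmooth D f)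
    (X : (n : ℕ) → (Fin n → ℝ) → Fin n → ℝ) (burn : (n : ℕ) → (Fin n → ℝ) → ℝ)
    (hMIR : TFM.IsMyersonInRange B D X burn) :
    ∃ U : (n : ℕ) → (Fin n → ℝ) → ℝ, ∀ n : ℕ,
      -- convex and non-decreasing in the virtual values
      (ConvexOn ℝ Set.univ (U n) ∧ Monotone (U n)) ∧
      -- zero partial derivative in every coordinate with a negative virtual value
      (∀ v : Fin n → ℝ, (∀ j, v j ∈ TFM.valueDomain D f) →
        ∀ i, TFM.virtualValue D f (v i) < 0 →
          TFM.IsPartialDerivAt (U n) i 0 (fun j => TFM.virtualValue D f (v j))) ∧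
      -- invariance under adding bids with non-positive virtual values
      (∀ (t : ℕ) (v : Fin (n + t) → ℝ), (∀ j, v j ∈ TFM.valueDomain D f) →
        (∀ k : Fin t, TFM.virtualValue D f (v (Fin.natAdd n k)) ≤ 0) →
          U (n + t) (fun j => TFM.virtualValue D f (v j)) =
            U n (fun i => TFM.virtualValue D f (v (Fin.castAdd t i)))) ∧
      -- almost surely the allocation is a subgradient, hence the gradient wherever it exists,
      -- and the burn identity holds
      (∀ᵐ v ∂(TFM.profileLaw D n),
        TFM.IsSubgradientAt (U n) (X n v) (fun j => TFM.virtualValue D f (v j)) ∧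
        (DifferentiableAt ℝ (U n) (fun j => TFM.virtualValue D f (v j)) →
          TFM.IsGradientAt (U n) (X n v) (fun j => TFM.virtualValue D f (v j))) ∧
        burn n v = ∑ i, TFM.virtualValue D f (v i) * X n v i
          - U n (fun j => TFM.virtualValue D f (v j))) ∧
      -- if no virtual value has positive probability, then the gradient exists almost surely
      ((∀ c : ℝ, D {x | TFM.virtualValue D f x = c} = 0) →
        ∀ᵐ v ∂(TFM.profileLaw D n),
          TFM.IsGradientAt (U n) (X n v) (fun j => TFM.virtualValue D f (v j))) := by
  have := hreg.prob
  have hB : ∀ n, TFM.IsBurnBounded B n := fun n => by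
    obtain ⟨M, s, hopt, -, -⟩ := hMIR n
    exact TFM.isBurnBounded_of_isRevenueOptimal hopt
  refine ⟨TFM.indirectUtility B, fun n => ?_⟩
  obtain ⟨M, s, hopt, hX, hburn⟩ := hMIR n
  have hX' : ∀ v, X n v = (M.play (M.messages s v)).userAlloc B := fun v => funext (hX v)
  have hae := hreg.ae_surplus_eq_indirectUtility hsmooth hopt
  have hsub : ∀ᵐ v ∂(TFM.profileLaw D n), TFM.IsSubgradientAt (TFM.indirectUtility B n) (X n v)
      (fun j => TFM.virtualValue D f (v j)) := by
    filter_upwards [hae] with v hv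
    rw [hX']
    exact (hB n).isSubgradientAt hv
  refine ⟨⟨(hB n).convexOn_indirectUtility, (hB n).monotone_indirectUtility⟩,
    fun v _ i hi => (hB n).isPartialDerivAt_zero hi,
    fun t v _ hv => TFM.indirectUtility_add (hB n) (hB (n + t)) _ hv, ?_, fun hatom => ?_⟩
  · filter_upwards [hae, hsub] with v hv hg
    refine ⟨hg, hg.isGradientAt, ?_⟩
    rw [hburn, ← hv, hX', TFM.OnChainPlay.surplus, sub_sub_cancel]
  · filter_upwards [hsub, TFM.ae_forall_differentiableAt_update hreg.measurable_virtualValue hatom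
      (hB n).convexOn_indirectUtility (hB n).continuous_indirectUtility] with v hg hd
    exact hg.isGradientAt_of_partial (hB n).convexOn_indirectUtility hd
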